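/- Throughout, $\log$ is the logarithm to base $2$. For $x\in\mathbb R$ and $b\ge 0$ let $[x]_b=2^{-b}\lfloor 2^b x\rfloor$ (the integer part of $x$ together with the first $b$ binary digits of its fractional part), and let $[\cdot]_b$ act coordinatewise on vectors. For a set $\mathcal X\subset\mathbb R$ put $\mathcal X_b=\{[x]_b:x\in\mathcal X\}$. Let $\mathbf X=\{X_i\}_{i\in\mathbb Z}$ be a real-valued stationary process with $X_i\in\mathcal X$ almost surely, and write $X^n=(X_1,\dots,X_n)$. Assume that $\mathbf X$ is $\Psi^*$-mixing: $\psi^*(g)\to1$ as $g\to\infty$, where $$\psi^*(g)=\sup\Big\{\frac{P(\mathcal A\cap\mathcal B)}{P(\mathcal A)P(\mathcal B)}:\ j\in\mathbb N,\ \mathcal A\in\sigma(X_i:i\le j),\ \mathcal B\in\sigma(X_i:i\ge j+g),\ P(\mathcal A)P(\mathcal B)>0\Big\}.$$ Let $\bar d_o(\mathbf X)=\lim_{k\to\infty}\bar d_k(\mathbf X)$ be its upper information dimension, where $\bar d_k(\mathbf X)=\limsup_{b\to\infty}\frac1b H([X_{k+1}]_b\mid[X^k]_b)$ and $H$ is the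 Shannon entropy in bits. For $u^n\in\mathbb R^n$ and $k\ge 0$, the $k$-th order empirical distribution of $u^n$ is $$\hat p_{k}(a^{k}\mid u^n)=\frac{|\{i: k+1\le i\le n,\ (u_{i-k},\dots,u_{i-1})=a^{k}\}|}{n-k}.$$ Define weights from $\hat p_{k+1}(\cdot\mid u^n)$ by $$w_{a^{k+1}}(u^n)=\log\frac{\sum_{c}\hat p_{k+1}(a^kc\mid u^n)}{\hat p_{k+1}(a^{k+1}\mid u^n)},\qquad w_{a^{k+1}}(u^n)=+\infty\ \text{ if }\ \hat p_{k+1}(a^{k+1}\mid u^n)=0 .$$ For weights $\mathbf w=(w_{a^{k+1}})$ let $c_{\mathbf w}(u^n)=\sum_{a^{k+1}\in\mathcal X_b^{k+1}}w_{a^{k+1}}\,\hat p_{k+1}(a^{k+1}\mid u^n)$, with $\infty\cdot0=0$. **Theorem.** Let $r>1$, $\delta>0$, $b=b_n=\lfloor r\log\log n\rfloor$ (read as $0$ for the finitely many $n$ for which this is negative or undefined), $\lambda=\lambda_n=(\log n)^{2r}$, let $m=m_n$ satisfy $m_n\ge(1+\delta)\,\bar d_o(\mathbf X)\,n$, where in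 the degenerate case $\bar d_o(\mathbf X)=0$ we also require $\liminf_{n\to\infty} m_n/n>0$, and let $k=k_n$ be a sequence with $k_n\to\infty$ and $k_n=o(\log n/\log\log n)$. For each $n$ let $A=A_n\in\mathbb R^{m\times n}$ be a random matrix with i.i.d. $\mathcal N(0,1)$ entries, independent of $X^n$, and let $Y^m=AX^n$. Let $\mathbf w=\mathbf w([X^n]_b)$ be the weights computed from the $(k+1)$-th order empirical distribution of the quantized input, and suppose that for all large $n$, almost surely, $\hat X^n$ is a minimizer $$\hat X^n\in\operatorname*{arg\,min}_{u^n\in\mathcal X_b^n}\Big[c_{\mathbf w}(u^n)+\frac{\lambda}{n^2}\|Au^n-Y^m\|_2^2\Big].$$ Then $\frac1{\sqrt n}\|X^n-\hat X^n\|_2\to0$ in probability as $n\to\infty$. -/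

import Mathlib

open MeasureTheory ProbabilityTheory Filter Topology
open scoped ENNReal

noncomputable section

namespace CompressedSensing

/-! ### Quantization -/

/-- The `i`-th binary digit (after the point) of the fractional part of `x`. -/
def binaryDigit (x : ℝ) (i : ℕ) : ℤ := ⌊(2 : ℝ) ^ i * (x - ⌊x⌋)⌋ % 2

/-- The `b`-bit quantization `[x]_b = ⌊x⌋ + ∑_{i=1}^b 2^{-i} a_i`, where `0.a₁a₂…` is the binary
representation of `x - ⌊x⌋`. -/
def quantize (b : ℕ) (x : ℝ) : ℝ :=
  (⌊x⌋ : ℝ) + ∑ i ∈ Finset.Icc 1 b, (binaryDigit x i : ℝ) / 2 ^ i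

/-- Closed form of the quantizer: rounding down to a multiple of `2^{-b}`. -/
theorem quantize_eq_floor_div (b : ℕ) (x : ℝ) :
    quantize b x = (⌊(2 : ℝ) ^ b * x⌋ : ℝ) / 2 ^ b := by
  have key : ∀ (y : ℝ) (b : ℕ),
      (∑ i ∈ Finset.Icc 1 b, ((⌊(2 : ℝ) ^ i * y⌋ % 2 : ℤ) : ℝ) / 2 ^ i) + ⌊y⌋
        = (⌊(2 : ℝ) ^ b * y⌋ : ℝ) / 2 ^ b := by
    intro y b
    induction b with
    | zero => simp
    | succ b ih =>
      rw [Finset.sum_Icc_succ_top (by omega), add_right_comm, ih]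
      have h1 : ⌊(2 : ℝ) ^ (b + 1) * y⌋ / 2 = ⌊(2 : ℝ) ^ b * y⌋ := by
        have h := Int.floor_div_natCast ((2 : ℝ) ^ (b + 1) * y) 2
        have e : (2 : ℝ) ^ (b + 1) * y / ((2 : ℕ) : ℝ) = (2 : ℝ) ^ b * y := by
          push_cast; ring
        rw [e] at h
        exact_mod_cast h.symm
      have h2 : (⌊(2 : ℝ) ^ (b + 1) * y⌋ : ℝ)
          = 2 * (⌊(2 : ℝ) ^ b * y⌋ : ℝ) + ((⌊(2 : ℝ) ^ (b + 1) * y⌋ % 2 : ℤ) : ℝ) := by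
        have := Int.mul_ediv_add_emod ⌊(2 : ℝ) ^ (b + 1) * y⌋ 2
        rw [h1] at this
        exact_mod_cast this.symm
      rw [h2, pow_succ]
      field_simp
  have h := key (x - ⌊x⌋) b
  have h0 : ⌊x - (⌊x⌋ : ℝ)⌋ = 0 := by simp
  have e : (2 : ℝ) ^ b * (x - ⌊x⌋) = (2 : ℝ) ^ b * x - (((2 : ℤ) ^ b * ⌊x⌋ : ℤ) : ℝ) := by
    push_cast; ring
  rw [h0, e, Int.floor_sub_intCast] at h
  unfold quantize binaryDigit
  simp only [Int.cast_zero, add_zero] at h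
  rw [h]
  push_cast
  field_simp
  ring

/-- The quantized alphabet `𝒳_b = {[x]_b : x ∈ 𝒳}`. -/
def quantizedAlphabet (𝒳 : Set ℝ) (b : ℕ) : Set ℝ := quantize b '' 𝒳

/-! ### Empirical distributions -/

open Classical in
/-- The `k`-th order empirical distribution
`p̂_k(a^k | u^n) = |{i : u_{i-k}^{i-1} = a^k, k+1 ≤ i ≤ n}| / (n - k)`;
the index `s` is `i - k - 1`, since coordinates are numbered from `0`. -/
def empDist {n : ℕ} (k : ℕ) (u : Fin n → ℝ) (a : Fin k → ℝ) : ℝ :=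
  ((Finset.univ.filter fun s : Fin (n - k) =>
      ∀ j : Fin k, u ⟨s.1 + j.1, by omega⟩ = a j).card : ℝ) / ((n : ℝ) - k)

/-- The marginal of `p̂_{k+1}(· | u^n)` on the first `k` letters,
`∑_{c} p̂_{k+1}(a^k c | u^n)` (only finitely many terms are nonzero). -/
def empMarginal {n : ℕ} (k : ℕ) (u : Fin n → ℝ) (a : Fin k → ℝ) : ℝ :=
  ∑' c : ℝ, empDist (k + 1) u (Fin.snoc (α := fun _ => ℝ) a c)

open Classical in
/-- The weights `w_{a^{k+1}} = log₂ (p̂_k(a^k | u) / p̂_{k+1}(a^{k+1} | u))`, that is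
`-log₂ p̂_{k+1}(a_{k+1} | a^k)`; the weight of a block that does not occur in `u` is `+∞`. -/
def empWeight {n : ℕ} (k : ℕ) (u : Fin n → ℝ) (a : Fin (k + 1) → ℝ) : ℝ≥0∞ :=
  if empDist (k + 1) u a = 0 then ∞
  else ENNReal.ofReal
    (Real.logb 2 (empMarginal k u (fun i => a i.castSucc) / empDist (k + 1) u a))

/-! ### The A-MEP decoder -/

/-- `c_w(u^n) = ∑_{a^{k+1} ∈ U^{k+1}} w_{a^{k+1}} p̂_{k+1}(a^{k+1} | u^n)`, with `∞ · 0 = 0`. -/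
def linearCost {n : ℕ} (k : ℕ) (U : Set ℝ) (w : (Fin (k + 1) → ℝ) → ℝ≥0∞)
    (u : Fin n → ℝ) : ℝ≥0∞ :=
  ∑' a : Fin (k + 1) → U,
    w (fun i => (a i : ℝ)) * ENNReal.ofReal (empDist (k + 1) u (fun i => (a i : ℝ)))

/-- The A-MEP objective `c_w(u^n) + (λ / n²) ‖A u^n - y^m‖²` (Euclidean norm). -/
def amepObjective {m n : ℕ} (k : ℕ) (U : Set ℝ) (w : (Fin (k + 1) → ℝ) → ℝ≥0∞) (lam : ℝ)
    (A : Matrix (Fin m) (Fin n) ℝ) (y : Fin m → ℝ) (u : Fin n → ℝ) : ℝ≥0∞ :=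
  linearCost k U w u +
    ENNReal.ofReal (lam / (n : ℝ) ^ 2 * ‖WithLp.toLp 2 (A.mulVec u - y)‖ ^ 2)

/-- `v` is a minimizer of the A-MEP objective over `U^n`. -/
def IsAMEPSolution {m n : ℕ} (k : ℕ) (U : Set ℝ) (w : (Fin (k + 1) → ℝ) → ℝ≥0∞) (lam : ℝ)
    (A : Matrix (Fin m) (Fin n) ℝ) (y : Fin m → ℝ) (v : Fin n → ℝ) : Prop :=
  (∀ i, v i ∈ U) ∧
    ∀ u : Fin n → ℝ, (∀ i, u i ∈ U) →
      amepObjective k U w lam A y v ≤ amepObjective k U w lam A y u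

/-- The quantization level `b_n = ⌊r log₂ log₂ n⌋` (`0` while this is negative). -/
def quantLevel (r : ℝ) (n : ℕ) : ℕ := ⌊r * Real.logb 2 (Real.logb 2 n)⌋₊

/-- The regularization coefficient `λ_n = (log₂ n)^{2r}`. -/
def regCoeff (r : ℝ) (n : ℕ) : ℝ := (Real.logb 2 n) ^ (2 * r)

/-! ### Stochastic processes -/

variable {Ω : Type*}

/-- The first `n` samples `X^n = (X₁, …, X_n)` of a process. -/
def initialBlock (X : ℤ → Ω → ℝ) (n : ℕ) (ω : Ω) : Fin n → ℝ := fun i => X ((i : ℤ) + 1) ω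

/-- Stationarity: the law of the process is invariant under time shifts. -/
def IsStationary [MeasurableSpace Ω] (X : ℤ → Ω → ℝ) (μ : Measure Ω) : Prop :=
  ∀ t : ℤ, μ.map (fun ω i => X (i + t) ω) = μ.map (fun ω i => X i ω)

/-- The `σ`-field `ℱ_{-∞}^j` generated by `X_i`, `i ≤ j`. -/
abbrev pastSigma (X : ℤ → Ω → ℝ) (j : ℤ) : MeasurableSpace Ω :=
  ⨆ i : ℤ, ⨆ _ : i ≤ j, MeasurableSpace.comap (X i) inferInstance

/-- The `σ`-field `ℱ_j^∞` generated by `X_i`, `j ≤ i`. -/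
abbrev futureSigma (X : ℤ → Ω → ℝ) (j : ℤ) : MeasurableSpace Ω :=
  ⨆ i : ℤ, ⨆ _ : j ≤ i, MeasurableSpace.comap (X i) inferInstance

/-- The mixing coefficient `ψ*(g)`: the supremum of `P(A ∩ B) / (P(A) P(B))` over `j ∈ ℕ`,
`A ∈ ℱ_{-∞}^j`, `B ∈ ℱ_{j+g}^∞` with `P(A) P(B) > 0`. -/
def psiStar [MeasurableSpace Ω] (X : ℤ → Ω → ℝ) (μ : Measure Ω) (g : ℕ) : ℝ≥0∞ :=
  ⨆ (j : ℕ) (A : Set Ω) (B : Set Ω) (_ : MeasurableSet[pastSigma X j] A)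
    (_ : MeasurableSet[futureSigma X (j + g)] B) (_ : 0 < μ A * μ B),
    μ (A ∩ B) / (μ A * μ B)

/-- `Ψ*`-mixing: `ψ*(g) → 1` as `g → ∞`. -/
def IsPsiStarMixing [MeasurableSpace Ω] (X : ℤ → Ω → ℝ) (μ : Measure Ω) : Prop :=
  Tendsto (psiStar X μ) atTop (𝓝 1)

/-- `P([X^k]_b = a^k)`. -/
def blockProb [MeasurableSpace Ω] (X : ℤ → Ω → ℝ) (μ : Measure Ω) (b k : ℕ) (a : Fin k → ℝ) : ℝ :=
  μ.real {ω | ∀ i, quantize b (initialBlock X k ω i) = a i}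

/-- The conditional Shannon entropy (in bits, possibly `∞`) `H([X_{k+1}]_b | [X^k]_b)`. -/
def condEntropy [MeasurableSpace Ω] (X : ℤ → Ω → ℝ) (μ : Measure Ω) (b k : ℕ) : ℝ≥0∞ :=
  ∑' a : Fin (k + 1) → ℝ, ENNReal.ofReal
    (-(blockProb X μ b (k + 1) a *
      Real.logb 2 (blockProb X μ b (k + 1) a / blockProb X μ b k (fun i => a i.castSucc))))

/-- The `k`-th order upper information dimension
`d̄_k(X) = limsup_{b → ∞} H([X_{k+1}]_b | [X^k]_b) / b`. -/
def upperInfoDimOrder [MeasurableSpace Ω] (X : ℤ → Ω → ℝ) (μ : Measure Ω) (k : ℕ) :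
    ℝ≥0∞ :=
  limsup (fun b : ℕ => condEntropy X μ b k / (b : ℝ≥0∞)) atTop

/-- `d` is the upper information dimension `d̄_o(X) = lim_{k → ∞} d̄_k(X)`. -/
def IsUpperInfoDim [MeasurableSpace Ω] (X : ℤ → Ω → ℝ) (μ : Measure Ω) (d : ℝ≥0∞) : Prop :=
  Tendsto (upperInfoDimOrder X μ) atTop (𝓝 d)

end CompressedSensing

end

/-! The decoder competes with the quantized signal `q = [X^n]_b`, and the proof is a union bound
over the sequences that can do as well as `q`. Fix `D` slightly above the information dimension, so
that `D n ≤ (1 - κ) m` for some `κ > 0`. Outside three unlikely events the error is small.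

(1) The cost of `q` under its own weights is its empirical conditional entropy. By Gibbs' inequality
(`linearCost_self_le`) this is at most the code length per letter under any conditional model. For a
model of fixed order built from the law of the process, mixing gives a weak law, so the cost is at
most `D b` with high probability (`linearCost_self_concentration`).

(2) The quantization error is at most `2^{-b}` per coordinate and independent of `A`, so by Markov
`‖A (x - q)‖² ≤ K m n / 4^b` (`measure_mulVec_gt_le`). As `λ` lies between `4^b` and `4 · 4^b`,
comparison with `q` shows that a minimizer `v` has total weight at most `n D b + 4 K m` and `‖A (v -
q)‖² ≤ (2 n² D b + 4 K m n) / 4^b` (`IsAMEPSolution.bounds`).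

(3) No grid sequence with these two properties has `‖v - q‖² ≥ σ n` (`measure_exists_bad_le`). Since
`2^{-weight}` is an empirical Markov kernel, a Kraft-type count bounds the choices of all letters
but the last by `2^{n D b + 4 K m} n^k` (`tsum_cost_le`). A far sequence passes the measurement test
with probability at most `(C b / 4^b)^{m/2} = 2^{-m b + (m/2) log (C b)}` (`measureReal_mulVec_le`).
The product has exponent at most `m (-κ b + 4 K + log (C b) / 2) + O(log² n)`, which tends to `-∞`
(`tendsto_unionBound`).

Two points come from an alphabet that may be unbounded. Code lengths are unbounded, so the weak law
needs finite entropy of the integer part of `X₁`, which is deduced from mixing and finite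
conditional entropies (`lintegral_floorProb_lt_top`). Moreover the last coordinate lies in no
window, so the cost does not restrict it; summing over it uses the decay of the small ball
probability in `‖v - q‖` (`tsum_lattice_le`). -/

noncomputable section

namespace CompressedSensing

section

/-! ### Counting the sequences of small cost -/

/-- The block of length `k + 1` of `u` that starts at position `s`. -/
def window {α : Type*} {n : ℕ} (k : ℕ) (u : Fin n → α) (s : Fin (n - (k + 1))) : Fin (k + 1) → α :=
  fun j => u ⟨s.1 + j.1, by omega⟩

open Classical in
/-- The number of windows of `u` equal to `a`. -/
def blockCount {n : ℕ} (k : ℕ) (u : Fin n → ℝ) (a : Fin (k + 1) → ℝ) : ℕ :=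
  (Finset.univ.filter fun s => window k u s = a).card

open Classical in
/-- The number of windows of `u` whose first `k` letters are `y`. -/
def contextCount {n : ℕ} (k : ℕ) (u : Fin n → ℝ) (y : Fin k → ℝ) : ℕ :=
  (Finset.univ.filter fun s => Fin.init (window k u s) = y).card

theorem empDist_eq {n : ℕ} (k : ℕ) (h : k + 1 ≤ n) (u : Fin n → ℝ) (a : Fin (k + 1) → ℝ) :
    empDist (k + 1) u a = (blockCount k u a : ℝ) / (n - (k + 1) : ℕ) := by
  unfold empDist blockCount
  rw [Nat.cast_sub h]
  congr 2
  congr 1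
  ext s
  simp [window, funext_iff]

theorem blockCount_pos_window {n : ℕ} (k : ℕ) (u : Fin n → ℝ) (s : Fin (n - (k + 1))) :
    0 < blockCount k u (window k u s) :=
  Finset.card_pos.2 ⟨s, by simp⟩

theorem blockCount_le_contextCount {n : ℕ} (k : ℕ) (u : Fin n → ℝ) (a : Fin (k + 1) → ℝ) :
    blockCount k u a ≤ contextCount k u (Fin.init a) := by
  classical
  refine Finset.card_le_card fun s hs => ?_
  simp only [Finset.mem_filter, Finset.mem_univ, true_and] at hs ⊢
  rw [hs]

/-- Each window contributes to exactly one letter `c`, its own last one. The semiring is arbitrary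
because the sum is needed in `ℝ` for `empMarginal` and in `ℝ≥0∞` for `empKernel`. -/
theorem hasSum_blockCount {n : ℕ} (k : ℕ) (u : Fin n → ℝ) (y : Fin k → ℝ) {R : Type*}
    [NonAssocSemiring R] [TopologicalSpace R] [ContinuousAdd R] :
    HasSum (fun c : ℝ => (blockCount k u (Fin.snoc (α := fun _ => ℝ) y c) : R))
      (contextCount k u y : R) := by
  classical
  simp only [blockCount, contextCount, Finset.card_filter, Nat.cast_sum]
  refine hasSum_sum fun s _ => ?_
  have key : ∀ c : ℝ, (((if window k u s = Fin.snoc (α := fun _ => ℝ) y c then 1 else 0 : ℕ)) : R)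
      = if c = window k u s (Fin.last k) then
        (((if Fin.init (window k u s) = y then 1 else 0 : ℕ)) : R) else 0 := by
    intro c
    have : window k u s = Fin.snoc (α := fun _ => ℝ) y c ↔
        c = window k u s (Fin.last k) ∧ Fin.init (window k u s) = y := by
      constructor
      · intro h; rw [h]; simp
      · rintro ⟨rfl, rfl⟩; simp
    simp only [this]
    by_cases h1 : c = window k u s (Fin.last k)
    · simp only [h1, true_and, if_true]
    · simp only [h1, false_and, if_false, Nat.cast_zero]
  simp only [key]
  exact hasSum_ite_eq _ _

theorem empMarginal_eq {n : ℕ} (k : ℕ) (h : k + 1 ≤ n) (u : Fin n → ℝ) (y : Fin k → ℝ) :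
    empMarginal k u y = (contextCount k u y : ℝ) / (n - (k + 1) : ℕ) := by
  unfold empMarginal
  simp only [empDist_eq k h]
  rw [tsum_div_const, (hasSum_blockCount k u y).tsum_eq]

theorem empWeight_eq {n : ℕ} (k : ℕ) (h : k + 1 < n) (q : Fin n → ℝ) (a : Fin (k + 1) → ℝ) :
    empWeight k q a = if blockCount k q a = 0 then ∞ else
      ENNReal.ofReal (Real.logb 2 ((contextCount k q (Fin.init a) : ℝ) / blockCount k q a)) := by
  have hM : ((n - (k + 1) : ℕ) : ℝ) ≠ 0 := by
    have : n - (k + 1) ≠ 0 := by omega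
    exact_mod_cast this
  unfold empWeight
  rw [empDist_eq k h.le, empMarginal_eq k h.le, div_div_div_cancel_right₀ hM]
  simp only [div_eq_zero_iff, hM, or_false, Nat.cast_eq_zero]
  rfl

/-- The cost is the average of the weights of the windows. -/
theorem linearCost_eq {n : ℕ} (k : ℕ) (h : k + 1 < n) (U : Set ℝ) (w : (Fin (k + 1) → ℝ) → ℝ≥0∞)
    (u : Fin n → ℝ) (hu : ∀ i, u i ∈ U) :
    linearCost k U w u = (∑ s, w (window k u s)) / ((n - (k + 1) : ℕ) : ℝ≥0∞) := by
  classical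
  have hM : (0 : ℝ) < ((n - (k + 1) : ℕ) : ℝ) := by
    have : 0 < n - (k + 1) := by omega
    exact_mod_cast this
  unfold linearCost
  have e : ∀ a : Fin (k + 1) → U, w (fun i => (a i : ℝ)) *
      ENNReal.ofReal (empDist (k + 1) u (fun i => (a i : ℝ)))
      = ∑ s, (if a = (fun j => (⟨window k u s j, hu _⟩ : U)) then
          w (window k u s) / ((n - (k + 1) : ℕ) : ℝ≥0∞) else 0) := by
    intro a
    rw [empDist_eq k h.le, ENNReal.ofReal_div_of_pos hM, ENNReal.ofReal_natCast,
      ENNReal.ofReal_natCast, blockCount, Finset.card_filter, Nat.cast_sum, ← mul_div_assoc,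
      Finset.mul_sum, div_eq_mul_inv, Finset.sum_mul]
    refine Finset.sum_congr rfl fun s _ => ?_
    by_cases hs : window k u s = fun i => (a i : ℝ)
    · have : a = (fun j => (⟨window k u s j, hu _⟩ : U)) := by
        funext j; apply Subtype.ext; simp [hs]
      rw [if_pos this, if_pos hs]
      simp [hs, div_eq_mul_inv]
    · have : a ≠ (fun j => (⟨window k u s j, hu _⟩ : U)) := by
        intro h'; apply hs; funext j; rw [h']
      rw [if_neg this, if_neg hs]
      simp
  simp only [e]
  rw [Summable.tsum_finsetSum (fun _ _ => ENNReal.summable)]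
  simp only [tsum_ite_eq]
  simp only [div_eq_mul_inv]
  rw [Finset.sum_mul]

/-- The empirical conditional probability of the letter `c` after the context `y`. -/
def empKernel {n : ℕ} (k : ℕ) (q : Fin n → ℝ) (y : Fin k → ℝ) (c : ℝ) : ℝ≥0∞ :=
  (blockCount k q (Fin.snoc (α := fun _ => ℝ) y c) : ℝ≥0∞) / contextCount k q y

/-- Equality fails for a context that does not occur: there `0 / 0 = 0` and the whole row vanishes.
-/
theorem tsum_empKernel_le {n : ℕ} (k : ℕ) (q : Fin n → ℝ) (y : Fin k → ℝ) :
    ∑' c, empKernel k q y c ≤ 1 := by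
  simp only [empKernel, div_eq_mul_inv]
  rw [ENNReal.tsum_mul_right, (hasSum_blockCount k q y).tsum_eq]
  exact ENNReal.mul_inv_le_one _

/-- Only blocks that occur in `q` have finite weight. Hence a sequence of finite cost has at most `n
^ k` possible initial contexts, even over an infinite alphabet. -/
theorem mem_range_of_empWeight_ne_top {n : ℕ} (k : ℕ) (h : k + 1 < n) (q : Fin n → ℝ)
    (a : Fin (k + 1) → ℝ) (ha : empWeight k q a ≠ ∞) (j : Fin (k + 1)) : a j ∈ Set.range q := by
  classical
  rw [empWeight_eq k h] at ha
  have : blockCount k q a ≠ 0 := by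
    intro h0; simp [h0] at ha
  obtain ⟨s, hs⟩ := Finset.card_pos.1 (Nat.pos_of_ne_zero this)
  simp only [Finset.mem_filter, Finset.mem_univ, true_and] at hs
  rw [← hs]
  exact ⟨_, rfl⟩

/-- Weights are ideal code lengths of the empirical kernel; this turns a cost bound into a lower
bound for a probability. -/
theorem empKernel_eq_rpow {n : ℕ} (k : ℕ) (h : k + 1 < n) (q : Fin n → ℝ)
    (a : Fin (k + 1) → ℝ) (ha : empWeight k q a ≠ ∞) :
    empKernel k q (Fin.init a) (a (Fin.last k)) =
      ENNReal.ofReal ((2 : ℝ) ^ (-(empWeight k q a).toReal)) := by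
  rw [empWeight_eq k h] at ha ⊢
  have h0 : blockCount k q a ≠ 0 := by
    intro h0; simp [h0] at ha
  have hle := blockCount_le_contextCount k q a
  have hb : (0 : ℝ) < blockCount k q a := by exact_mod_cast Nat.pos_of_ne_zero h0
  have hc : (0 : ℝ) < contextCount k q (Fin.init a) := by
    exact_mod_cast lt_of_lt_of_le (Nat.pos_of_ne_zero h0) hle
  rw [if_neg h0, ENNReal.toReal_ofReal, Real.rpow_neg two_pos.le, Real.rpow_logb two_pos (by norm_num)
    (by positivity), inv_div, empKernel, ENNReal.ofReal_div_of_pos hc]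
  · simp
  · apply Real.logb_nonneg (by norm_num)
    rw [le_div_iff₀ hb, one_mul]
    exact_mod_cast hle

/-- A sequence of small cost has large probability under the empirical kernel. -/
theorem one_le_prod_empKernel {n : ℕ} (k : ℕ) (h : k + 1 < n) (q u : Fin n → ℝ) (B : ℝ)
    (hB0 : 0 ≤ B) (hB : ∑ s, empWeight k q (window k u s) ≤ ENNReal.ofReal B) :
    1 ≤ ENNReal.ofReal ((2 : ℝ) ^ B) *
      ∏ s, empKernel k q (Fin.init (window k u s)) (window k u s (Fin.last k)) := by
  have hfin : ∀ s, empWeight k q (window k u s) ≠ ∞ := by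
    intro s
    exact ((Finset.single_le_sum (fun _ _ => zero_le) (Finset.mem_univ s)).trans
      hB).trans_lt ENNReal.ofReal_lt_top |>.ne
  rw [Finset.prod_congr rfl fun s _ => empKernel_eq_rpow k h q _ (hfin s),
    ← ENNReal.ofReal_prod_of_nonneg (fun _ _ => by positivity),
    ← ENNReal.ofReal_mul (by positivity), ← ENNReal.ofReal_one]
  apply ENNReal.ofReal_le_ofReal
  rw [← Real.rpow_sum_of_pos two_pos, ← Real.rpow_add two_pos]
  apply Real.one_le_rpow (by norm_num)
  rw [Finset.sum_neg_distrib, ← ENNReal.toReal_sum (fun s _ => hfin s)]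
  have hs : (∑ s, empWeight k q (window k u s)).toReal ≤ max B 0 := by
    rw [← ENNReal.toReal_ofReal']
    exact ENNReal.toReal_mono ENNReal.ofReal_ne_top hB
  rw [max_eq_left hB0] at hs
  linarith

theorem tsum_fin_snoc {α : Type*} (N : ℕ) (f : (Fin (N + 1) → α) → ℝ≥0∞) :
    ∑' u, f u = ∑' (u : Fin N → α) (c : α), f (Fin.snoc (α := fun _ => α) u c) := by
  rw [← (Fin.snocEquiv (fun _ : Fin (N + 1) => α)).tsum_eq, ENNReal.tsum_prod', ENNReal.tsum_comm]
  rfl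

/-- A Markov chain of order `k` has total mass at most that of its initial distribution. -/
theorem tsum_prod_kernel_le {α : Type*} (k M : ℕ) (I : (Fin k → α) → ℝ≥0∞)
    (K : (Fin k → α) → α → ℝ≥0∞) (hK : ∀ y, ∑' c, K y c ≤ 1) :
    ∑' u : Fin (k + M) → α, I (fun j => u (Fin.castAdd M j)) *
      ∏ s : Fin M, K (fun j => u ⟨s.1 + j.1, by omega⟩) (u ⟨s.1 + k, by omega⟩) ≤ ∑' y, I y := by
  induction M with
  | zero => simp
  | succ M ih =>
    -- The last letter is summed out first: its kernel factor has mass at most 1 and leaves the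
    -- chain that is one step shorter.
    refine le_trans ?_ ih
    refine (tsum_fin_snoc (k + M) _).trans_le ?_
    refine ENNReal.tsum_le_tsum fun (u : Fin (k + M) → α) => ?_
    have e : ∀ c : α, I (fun j => (Fin.snoc (α := fun _ => α) u c : Fin (k + (M + 1)) → α)
          (Fin.castAdd (M + 1) j)) *
        ∏ s : Fin (M + 1), K (fun j => (Fin.snoc (α := fun _ => α) u c : Fin (k + (M + 1)) → α)
            ⟨s.1 + j.1, by change _ < k + M + 1; omega⟩)
          ((Fin.snoc (α := fun _ => α) u c : Fin (k + (M + 1)) → α) ⟨s.1 + k, by change _ < k + M + 1; omega⟩)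
        = (I (fun j => u (Fin.castAdd M j)) *
      ∏ s : Fin M, K (fun j => u ⟨s.1 + j.1, by omega⟩) (u ⟨s.1 + k, by omega⟩)) *
        K (fun j => u ⟨M + j.1, by omega⟩) c := by
      intro c
      have h1 : ∀ (i : ℕ) (hi : i < k + M) (hi' : i < k + (M + 1)),
          (Fin.snoc (α := fun _ => α) u c : Fin (k + (M + 1)) → α) ⟨i, hi'⟩ = u ⟨i, hi⟩ := by
        intro i hi hi'
        exact Fin.snoc_castSucc (α := fun _ => α) c u ⟨i, hi⟩
      have h2 : ∀ (i : ℕ) (hi : i = k + M) (hi' : i < k + (M + 1)),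
          (Fin.snoc (α := fun _ => α) u c : Fin (k + (M + 1)) → α) ⟨i, hi'⟩ = c := by
        intro i hi hi'
        subst hi
        exact Fin.snoc_last (α := fun _ => α) c u
      rw [Fin.prod_univ_castSucc, ← mul_assoc]
      congr 1
      · congr 1
        · congr 1
          funext j
          exact h1 _ _ _
        · refine Finset.prod_congr rfl fun s _ => ?_
          congr 1
          · funext j
            exact h1 _ _ _
          · exact h1 _ (by simp; omega) _
      · congr 1
        · funext j
          exact h1 _ (by simp; omega) _
        · exact h2 _ (by simp; omega) _
    simp only [e]
    rw [ENNReal.tsum_mul_left]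
    exact mul_le_of_le_one_right' (hK _)

theorem tsum_ite_comp_eq_le {ι κ β : Type*} (e : ι → β) (he : Function.Injective e) (x : κ → β)
    [∀ y : κ → ι, Decidable ((fun j => e (y j)) = x)] :
    ∑' y : κ → ι, (if (fun j => e (y j)) = x then (1 : ℝ≥0∞) else 0) ≤ 1 := by
  classical
  by_cases h : ∃ y0 : κ → ι, (fun j => e (y0 j)) = x
  · obtain ⟨y0, rfl⟩ := h
    have : ∀ y : κ → ι, (fun j => e (y j)) = (fun j => e (y0 j)) ↔ y = y0 := by
      intro y
      simp only [funext_iff, he.eq_iff]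
    simp [this]
  · push Not at h
    simp [h]

open Classical in
/-- The number of sequences of cost at most `B`, whose last letter is weighted by `g`. -/
theorem tsum_cost_le {ι : Type*} (e : ι → ℝ) (he : Function.Injective e) (k M : ℕ) (hM : 0 < M)
    (q : Fin (k + M + 1) → ℝ) (B : ℝ) (hB : 0 ≤ B) (g : ι → ℝ≥0∞) :
    ∑' u : Fin (k + M + 1) → ι,
      (if ∑ s, empWeight k q (window k (fun i => e (u i)) s) ≤ ENNReal.ofReal B
        then g (u (Fin.last _)) else 0) ≤
      ENNReal.ofReal ((2 : ℝ) ^ B) * ((k + M + 1 : ℕ) : ℝ≥0∞) ^ k * ∑' z, g z := by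
  have hk : k + 1 < k + M + 1 := by omega
  -- The chain starts from the counting measure on contexts with letters from `q`, instead of a
  -- probability; its mass is the factor `n ^ k`.
  set I : (Fin k → ι) → ℝ≥0∞ := fun y => if ∀ j, e (y j) ∈ Set.range q then 1 else 0 with hI
  set K : (Fin k → ι) → ι → ℝ≥0∞ := fun y c => empKernel k q (fun j => e (y j)) (e c) with hK
  have hK1 : ∀ y, ∑' c, K y c ≤ 1 := fun y =>
    (ENNReal.tsum_comp_le_tsum_of_injective he (empKernel k q fun j => e (y j))).trans
      (tsum_empKernel_le k q _)
  have hI1 : ∑' y, I y ≤ ((k + M + 1 : ℕ) : ℝ≥0∞) ^ k := by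
    calc ∑' y, I y ≤ ∑' y : Fin k → ι, ∑ x : Fin k → Fin (k + M + 1),
          (if (fun j => e (y j)) = (fun j => q (x j)) then (1 : ℝ≥0∞) else 0) := by
          refine ENNReal.tsum_le_tsum fun y => ?_
          by_cases hy : ∀ j, e (y j) ∈ Set.range q
          · simp only [hI, hy, implies_true, if_true]
            choose x hx using hy
            have := Finset.single_le_sum (f := fun x : Fin k → Fin (k + M + 1) =>
              (if (fun j => e (y j)) = (fun j => q (x j)) then (1 : ℝ≥0∞) else 0))
              (fun _ _ => zero_le) (Finset.mem_univ x)
            simpa [hx] using this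
          · rw [hI]
            exact (if_neg hy).trans_le zero_le
      _ = ∑ x : Fin k → Fin (k + M + 1), ∑' y : Fin k → ι,
          (if (fun j => e (y j)) = (fun j => q (x j)) then (1 : ℝ≥0∞) else 0) :=
          Summable.tsum_finsetSum fun _ _ => ENNReal.summable
      _ ≤ ∑ x : Fin k → Fin (k + M + 1), 1 :=
          Finset.sum_le_sum fun x _ => tsum_ite_comp_eq_le e he _
      _ = _ := by simp
  -- The `M` windows cover only the indices `0, …, k + M - 1`. The last letter therefore enters no
  -- weight and meets only the factor `g`.
  have key : ∀ u : Fin (k + M + 1) → ι,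
      (if ∑ s, empWeight k q (window k (fun i => e (u i)) s) ≤ ENNReal.ofReal B
        then g (u (Fin.last _)) else 0) ≤
      ENNReal.ofReal ((2 : ℝ) ^ B) * (I (fun j => u (Fin.castSucc (Fin.castAdd M j))) *
        ∏ s : Fin M, K (fun j => u (Fin.castSucc ⟨s.1 + j.1, by omega⟩))
          (u (Fin.castSucc ⟨s.1 + k, by omega⟩))) * g (u (Fin.last _)) := by
    intro u
    split_ifs with hu
    · have h1 := one_le_prod_empKernel k hk q (fun i => e (u i)) B hB hu
      have h2 : I (fun j => u (Fin.castSucc (Fin.castAdd M j))) = 1 := by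
        rw [hI]
        refine if_pos fun j => ?_
        have h3 : empWeight k q (window k (fun i => e (u i)) ⟨0, by omega⟩) ≠ ∞ :=
          ((Finset.single_le_sum (fun _ _ => zero_le) (Finset.mem_univ _)).trans
            hu).trans_lt ENNReal.ofReal_lt_top |>.ne
        have h4 := mem_range_of_empWeight_ne_top k hk q _ h3 j.castSucc
        simp only [window, Fin.val_castSucc, zero_add] at h4
        exact h4
      have h3 : (∏ s, empKernel k q (Fin.init (window k (fun i => e (u i)) s))
            (window k (fun i => e (u i)) s (Fin.last k)))
          = ∏ s : Fin M, K (fun j => u (Fin.castSucc ⟨s.1 + j.1, by omega⟩))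
          (u (Fin.castSucc ⟨s.1 + k, by omega⟩)) :=
        Fintype.prod_equiv (finCongr (by omega)) _ _ fun s => rfl
      rw [h2, one_mul, ← h3]
      exact le_mul_of_one_le_left' h1
    · exact zero_le
  calc _ ≤ ∑' u : Fin (k + M + 1) → ι, _ := ENNReal.tsum_le_tsum key
    _ = ENNReal.ofReal ((2 : ℝ) ^ B) * (∑' u : Fin (k + M) → ι,
        I (fun j => u (Fin.castAdd M j)) *
        ∏ s : Fin M, K (fun j => u ⟨s.1 + j.1, by omega⟩) (u ⟨s.1 + k, by omega⟩)) * ∑' z, g z := by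
      rw [tsum_fin_snoc]
      simp only [Fin.snoc_castSucc, Fin.snoc_last]
      simp only [ENNReal.tsum_mul_left, ENNReal.tsum_mul_right]
    _ ≤ _ := by
      gcongr
      exact (tsum_prod_kernel_le k M I K hK1).trans hI1

end

section

/-! ### The empirical conditional entropy is at most the code length of any conditional model -/

/-- This bounds the empirical mean of the likelihood ratio of `Q` to the empirical kernel by 1.
Grouping windows by their value cancels `blockCount`; summing `Q` over the last letter gives at most
1 per context; the context counts add up to the number of windows. -/
theorem sum_mul_context_div_block_le {n : ℕ} (k : ℕ) (q : Fin n → ℝ) (Q : (Fin k → ℝ) → ℝ → ℝ)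
    (hQ0 : ∀ y c, 0 ≤ Q y c)
    (hQ1 : ∀ y, ∑ c ∈ Finset.univ.image q, Q y c ≤ 1) :
    ∑ s, Q (Fin.init (window k q s)) (window k q s (Fin.last k)) *
      ((contextCount k q (Fin.init (window k q s)) : ℝ) / blockCount k q (window k q s)) ≤
      ((n - (k + 1) : ℕ) : ℝ) := by
  classical
  set f : (Fin (k + 1) → ℝ) → ℝ := fun a => Q (Fin.init a) (a (Fin.last k)) *
    ((contextCount k q (Fin.init a) : ℝ) / blockCount k q a) with hf
  set g : (Fin k → ℝ) × ℝ → ℝ := fun p => Q p.1 p.2 * contextCount k q p.1 with hg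
  set W := Finset.univ.image (window k q) with hW
  set Y := Finset.univ.image (fun s => Fin.init (window k q s)) with hY
  have h1 : ∑ s, f (window k q s) = ∑ a ∈ W, g (Fin.init a, a (Fin.last k)) := by
    rw [Finset.sum_comp f (window k q)]
    refine Finset.sum_congr rfl fun a ha => ?_
    obtain ⟨s, -, rfl⟩ := Finset.mem_image.1 ha
    have hb : (blockCount k q (window k q s) : ℝ) ≠ 0 := by
      exact_mod_cast (blockCount_pos_window k q s).ne'
    have : (Finset.univ.filter fun t => window k q t = window k q s).card
        = blockCount k q (window k q s) := rfl
    rw [this, nsmul_eq_mul, hf, hg]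
    field_simp
  have hinj : Set.InjOn (fun a : Fin (k + 1) → ℝ => (Fin.init a, a (Fin.last k))) W := by
    intro a _ a' _ h
    simp only [Prod.mk.injEq] at h
    rw [← Fin.snoc_init_self a, ← Fin.snoc_init_self a', h.1, h.2]
  have h2 : ∑ a ∈ W, g (Fin.init a, a (Fin.last k)) ≤
      ∑ p ∈ Y ×ˢ Finset.univ.image q, g p := by
    rw [← Finset.sum_image hinj]
    refine Finset.sum_le_sum_of_subset_of_nonneg ?_ fun p _ _ =>
      mul_nonneg (hQ0 _ _) (Nat.cast_nonneg _)
    intro p hp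
    obtain ⟨a, ha, rfl⟩ := Finset.mem_image.1 hp
    obtain ⟨s, -, rfl⟩ := Finset.mem_image.1 ha
    exact Finset.mem_product.2 ⟨Finset.mem_image_of_mem _ (Finset.mem_univ _),
      Finset.mem_image_of_mem _ (Finset.mem_univ _)⟩
  have h3 : ∑ p ∈ Y ×ˢ Finset.univ.image q, g p ≤ ∑ y ∈ Y, (contextCount k q y : ℝ) := by
    rw [Finset.sum_product]
    refine Finset.sum_le_sum fun y _ => ?_
    simp only [hg]
    rw [← Finset.sum_mul]
    exact mul_le_of_le_one_left (Nat.cast_nonneg _) (hQ1 y)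
  have h4 : ∑ y ∈ Y, (contextCount k q y : ℝ) = ((n - (k + 1) : ℕ) : ℝ) := by
    have := Finset.card_eq_sum_card_image (fun s => Fin.init (window k q s)) Finset.univ
    rw [Finset.card_univ, Fintype.card_fin] at this
    conv_rhs => rw [this]
    push_cast
    rfl
  exact (h1.trans_le h2).trans (h3.trans_eq h4)

/-- Gibbs' inequality for empirical distributions: the empirical conditional entropy of `q` is at
most the normalized ideal code length of `q` under any conditional model `Q`. -/
theorem linearCost_self_le {n : ℕ} (k : ℕ) (h : k + 1 < n) (U : Set ℝ) (q : Fin n → ℝ)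
    (hq : ∀ i, q i ∈ U) (Q : (Fin k → ℝ) → ℝ → ℝ) (hQ0 : ∀ y c, 0 ≤ Q y c)
    (hQ1 : ∀ y, ∑ c ∈ Finset.univ.image q, Q y c ≤ 1)
    (hQpos : ∀ s, 0 < Q (Fin.init (window k q s)) (window k q s (Fin.last k))) :
    linearCost k U (empWeight k q) q ≤ ENNReal.ofReal
      ((∑ s, -Real.logb 2 (Q (Fin.init (window k q s)) (window k q s (Fin.last k)))) /
        ((n - (k + 1) : ℕ) : ℝ)) := by
  have hM : (0 : ℝ) < ((n - (k + 1) : ℕ) : ℝ) := by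
    have : 0 < n - (k + 1) := by omega
    exact_mod_cast this
  have hb : ∀ s, (0 : ℝ) < blockCount k q (window k q s) := fun s => by
    exact_mod_cast blockCount_pos_window k q s
  have hbc : ∀ s, (blockCount k q (window k q s) : ℝ) ≤
      contextCount k q (Fin.init (window k q s)) := fun s => by
    exact_mod_cast blockCount_le_contextCount k q _
  have hw : ∀ s, empWeight k q (window k q s) = ENNReal.ofReal (Real.logb 2
      ((contextCount k q (Fin.init (window k q s)) : ℝ) / blockCount k q (window k q s))) := by
    intro s
    rw [empWeight_eq k h, if_neg (blockCount_pos_window k q s).ne']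
  rw [linearCost_eq k h U _ q hq, Finset.sum_congr rfl fun s _ => hw s,
    ← ENNReal.ofReal_sum_of_nonneg, ← ENNReal.ofReal_natCast, ← ENNReal.ofReal_div_of_pos hM]
  swap
  · intro s _
    apply Real.logb_nonneg (by norm_num)
    rw [le_div_iff₀ (hb s), one_mul]
    exact hbc s
  apply ENNReal.ofReal_le_ofReal
  gcongr ?_ / _
  rw [← sub_nonpos, ← Finset.sum_sub_distrib]
  -- Gibbs' inequality in the form `log x ≤ x - 1`, with `x` the likelihood ratio of `Q` to the
  -- empirical kernel.
  have hlog : ∀ s, Real.logb 2 ((contextCount k q (Fin.init (window k q s)) : ℝ) /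
        blockCount k q (window k q s)) -
      -Real.logb 2 (Q (Fin.init (window k q s)) (window k q s (Fin.last k))) ≤
      (Q (Fin.init (window k q s)) (window k q s (Fin.last k)) *
      ((contextCount k q (Fin.init (window k q s)) : ℝ) / blockCount k q (window k q s)) - 1) /
        Real.log 2 := by
    intro s
    have hc : (0 : ℝ) < (contextCount k q (Fin.init (window k q s)) : ℝ) /
        blockCount k q (window k q s) := div_pos ((hb s).trans_le (hbc s)) (hb s)
    rw [sub_neg_eq_add, add_comm, ← Real.logb_mul (hQpos s).ne' hc.ne', Real.logb]
    have := Real.log_pos one_lt_two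
    gcongr
    exact Real.log_le_sub_one_of_pos (mul_pos (hQpos s) hc)
  refine (Finset.sum_le_sum fun s _ => hlog s).trans ?_
  rw [← Finset.sum_div, Finset.sum_sub_distrib]
  refine div_nonpos_of_nonpos_of_nonneg ?_ (Real.log_pos one_lt_two).le
  have := sum_mul_context_div_block_le k q Q hQ0 hQ1
  simp only [Finset.sum_const, Finset.card_univ, Fintype.card_fin, nsmul_eq_mul, mul_one]
  linarith

end

section

/-! ### Quantized blocks of a stationary process -/

theorem floor_quantize (b : ℕ) (x : ℝ) : ⌊quantize b x⌋ = ⌊x⌋ := by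
  rw [quantize_eq_floor_div]
  have h1 := Int.floor_div_natCast ((⌊(2 : ℝ) ^ b * x⌋ : ℤ) : ℝ) (2 ^ b)
  have h2 := Int.floor_div_natCast ((2 : ℝ) ^ b * x) (2 ^ b)
  push_cast at h1 h2
  rw [h1, Int.floor_intCast, ← h2]
  congr 1
  field_simp

theorem quantize_le (b : ℕ) (x : ℝ) : quantize b x ≤ x := by
  rw [quantize_eq_floor_div, div_le_iff₀ (by positivity), mul_comm]
  exact Int.floor_le _

theorem sub_quantize_lt (b : ℕ) (x : ℝ) : x - quantize b x < (1 / 2) ^ b := by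
  rw [quantize_eq_floor_div, one_div, inv_pow, sub_lt_iff_lt_add, ← one_div, ← add_div,
    lt_div_iff₀ (by positivity), mul_comm, add_comm]
  exact Int.lt_floor_add_one _

/-- The point of the grid `2^{-b} ℤ` with index `z`. -/
def gridPoint (b : ℕ) (z : ℤ) : ℝ := (z : ℝ) / 2 ^ b

theorem gridPoint_injective (b : ℕ) : Function.Injective (gridPoint b) := by
  intro x y h
  have h2 : (2 : ℝ) ^ b ≠ 0 := by positivity
  simpa [gridPoint, div_left_inj' h2] using h

theorem gridPoint_floor (b : ℕ) (x : ℝ) : gridPoint b ⌊(2 : ℝ) ^ b * x⌋ = quantize b x :=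
  (quantize_eq_floor_div b x).symm

theorem measurable_floor_block (b K : ℕ) :
    Measurable fun (x : Fin K → ℝ) (i : Fin K) => ⌊(2 : ℝ) ^ b * x i⌋ :=
  measurable_pi_lambda _ fun i => ((measurable_pi_apply i).const_mul _).floor

/-- No measurability of `F` is required, because the map factors through the countable discrete
space `Fin K → ℤ`. -/
theorem measurable_comp_quantize {β : Type*} [MeasurableSpace β] (b K : ℕ)
    (F : (Fin K → ℝ) → β) : Measurable fun x : Fin K → ℝ => F (fun i => quantize b (x i)) := by
  have h : Measurable fun z : Fin K → ℤ => F (fun i => gridPoint b (z i)) :=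
    measurable_of_countable _
  simpa only [Function.comp_def, gridPoint_floor] using h.comp (measurable_floor_block b K)

theorem measurable_quantize (b : ℕ) : Measurable (quantize b) := by
  have : quantize b = fun x => (⌊(2 : ℝ) ^ b * x⌋ : ℝ) / 2 ^ b :=
    funext (quantize_eq_floor_div b)
  rw [this]
  have h : Measurable fun x : ℝ => ⌊(2 : ℝ) ^ b * x⌋ := (measurable_id.const_mul _).floor
  exact ((measurable_of_countable (fun z : ℤ => (z : ℝ))).comp h).div_const _

variable {Ω : Type*} [MeasurableSpace Ω] {X : ℤ → Ω → ℝ} {μ : Measure Ω}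

/-- The `K` samples `X_{t+1}, …, X_{t+K}`. -/
def shiftedBlock (X : ℤ → Ω → ℝ) (K : ℕ) (t : ℤ) (ω : Ω) : Fin K → ℝ := fun i => X (i + 1 + t) ω

theorem measurable_shiftedBlock (hX : ∀ i, Measurable (X i)) (K : ℕ) (t : ℤ) :
    Measurable (shiftedBlock X K t) := measurable_pi_lambda _ fun _ => hX _

theorem measurable_initialBlock (hX : ∀ i, Measurable (X i)) (K : ℕ) :
    Measurable (initialBlock X K) := measurable_pi_lambda _ fun _ => hX _

theorem lintegral_shiftedBlock (hX : ∀ i, Measurable (X i)) (hstat : IsStationary X μ) (K : ℕ)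
    (t : ℤ) (F : (Fin K → ℝ) → ℝ≥0∞) (hF : Measurable F) :
    ∫⁻ ω, F (shiftedBlock X K t ω) ∂μ = ∫⁻ ω, F (initialBlock X K ω) ∂μ := by
  have hG : Measurable fun x : ℤ → ℝ => F (fun i : Fin K => x (i + 1)) :=
    hF.comp (measurable_pi_lambda _ fun i => measurable_pi_apply _)
  have h1 : Measurable fun ω (i : ℤ) => X (i + t) ω := measurable_pi_lambda _ fun _ => hX _
  have h2 : Measurable fun ω (i : ℤ) => X i ω := measurable_pi_lambda _ fun _ => hX _
  have := congrArg (fun ν => ∫⁻ x, F (fun i : Fin K => x (i + 1)) ∂ν) (hstat t)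
  rwa [lintegral_map hG h1, lintegral_map hG h2] at this

theorem ae_shiftedBlock (hX : ∀ i, Measurable (X i)) (hstat : IsStationary X μ) (K : ℕ)
    (t : ℤ) (p : (Fin K → ℝ) → Prop) (hp : MeasurableSet {x | p x})
    (h : ∀ᵐ ω ∂μ, p (initialBlock X K ω)) : ∀ᵐ ω ∂μ, p (shiftedBlock X K t ω) := by
  classical
  have hm : Measurable ({x | p x}ᶜ.indicator fun _ => (1 : ℝ≥0∞)) :=
    measurable_const.indicator hp.compl
  have e := lintegral_shiftedBlock hX hstat K t _ hm
  have h0 : ∫⁻ ω, ({x | p x}ᶜ.indicator fun _ => (1 : ℝ≥0∞)) (initialBlock X K ω) ∂μ = 0 := by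
    refine (lintegral_eq_zero_iff (hm.comp (measurable_initialBlock hX K))).2 ?_
    filter_upwards [h] with ω hω
    simp [hω]
  filter_upwards [(lintegral_eq_zero_iff (hm.comp (measurable_shiftedBlock hX K t))).1
    (e.trans h0)] with ω hω
  by_contra hc
  simp [hc] at hω

/-- The integral is a countable sum over grid blocks, which embed injectively into the uncountable
index set of the sum on the right. -/
theorem lintegral_quantize_le [IsFiniteMeasure μ] (hX : ∀ i, Measurable (X i)) (b K : ℕ)
    (F : (Fin K → ℝ) → ℝ≥0∞) :
    ∫⁻ ω, F (fun i => quantize b (initialBlock X K ω i)) ∂μ ≤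
      ∑' a, F a * ENNReal.ofReal (blockProb X μ b K a) := by
  set Z : Ω → Fin K → ℤ := fun ω i => ⌊(2 : ℝ) ^ b * initialBlock X K ω i⌋ with hZ
  have hZm : Measurable Z := (measurable_floor_block b K).comp (measurable_initialBlock hX K)
  have hinj : Function.Injective fun (z : Fin K → ℤ) i => gridPoint b (z i) := fun z z' h =>
    funext fun i => gridPoint_injective b (congrFun h i)
  calc ∫⁻ ω, F (fun i => quantize b (initialBlock X K ω i)) ∂μ
      = ∫⁻ z, F (fun i => gridPoint b (z i)) ∂(μ.map Z) := by
        rw [lintegral_map (measurable_of_countable _) hZm]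
        simp only [hZ, gridPoint_floor]
    _ = ∑' z : Fin K → ℤ, F (fun i => gridPoint b (z i)) *
          ENNReal.ofReal (blockProb X μ b K (fun i => gridPoint b (z i))) := by
        rw [lintegral_countable']
        refine tsum_congr fun z => ?_
        rw [Measure.map_apply hZm (measurableSet_singleton z), blockProb, ofReal_measureReal]
        congr 2
        ext ω
        simp only [hZ, Set.mem_preimage, Set.mem_singleton_iff, Set.mem_ofPred_eq, funext_iff,
          ← gridPoint_floor, (gridPoint_injective b).eq_iff]
    _ ≤ _ := ENNReal.tsum_comp_le_tsum_of_injective hinj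
        (fun a => F a * ENNReal.ofReal (blockProb X μ b K a))

/-- The observed block almost surely has positive probability, so the logarithms and quotients below
are almost surely not evaluated at their default values. -/
theorem ae_blockProb_pos [IsFiniteMeasure μ] (hX : ∀ i, Measurable (X i)) (b K : ℕ) :
    ∀ᵐ ω ∂μ, 0 < blockProb X μ b K (fun i => quantize b (initialBlock X K ω i)) := by
  classical
  have h := lintegral_quantize_le (μ := μ) hX b K
    (fun a => if blockProb X μ b K a = 0 then 1 else 0)
  have h0 : ∑' a, (if blockProb X μ b K a = 0 then (1 : ℝ≥0∞) else 0) *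
      ENNReal.ofReal (blockProb X μ b K a) = 0 := by
    refine ENNReal.tsum_eq_zero.2 fun a => ?_
    split_ifs with h <;> simp [h]
  rw [h0, nonpos_iff_eq_zero, lintegral_eq_zero_iff] at h
  · filter_upwards [h] with ω hω
    refine lt_of_le_of_ne measureReal_nonneg fun hc => ?_
    simp [← hc] at hω
  · exact (measurable_comp_quantize b K
      (fun a => if blockProb X μ b K a = 0 then (1 : ℝ≥0∞) else 0)).comp
        (measurable_initialBlock hX K)

/-- The conditional self-information `-log₂ P([X_{k+1}]_b = a_{k+1} | [X^k]_b = a^k)`. -/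
def condInfo (X : ℤ → Ω → ℝ) (μ : Measure Ω) (b k : ℕ) (a : Fin (k + 1) → ℝ) : ℝ :=
  -Real.logb 2 (blockProb X μ b (k + 1) a / blockProb X μ b k (Fin.init a))

theorem lintegral_condInfo_le [IsFiniteMeasure μ] (hX : ∀ i, Measurable (X i)) (b k : ℕ) :
    ∫⁻ ω, ENNReal.ofReal (condInfo X μ b k (fun i => quantize b (initialBlock X (k + 1) ω i))) ∂μ
      ≤ condEntropy X μ b k := by
  refine (lintegral_quantize_le hX b (k + 1) fun a => ENNReal.ofReal (condInfo X μ b k a)).trans ?_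
  refine ENNReal.tsum_le_tsum fun a => ?_
  rw [← ENNReal.ofReal_mul' (by exact measureReal_nonneg)]
  apply ENNReal.ofReal_le_ofReal
  rw [condInfo, neg_mul, mul_comm]
  rfl

/-! ### Consequences of mixing -/

theorem pastSigma_le (hX : ∀ i, Measurable (X i)) (j : ℤ) :
    pastSigma X j ≤ (inferInstance : MeasurableSpace Ω) :=
  iSup₂_le fun i _ => (hX i).comap_le

theorem futureSigma_le (hX : ∀ i, Measurable (X i)) (j : ℤ) :
    futureSigma X j ≤ (inferInstance : MeasurableSpace Ω) :=
  iSup₂_le fun i _ => (hX i).comap_le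

theorem measurable_pastSigma {Ω : Type*} {X : ℤ → Ω → ℝ} {i j : ℤ} (h : i ≤ j) : Measurable[pastSigma X j] (X i) :=
  measurable_iff_comap_le.2 (le_iSup₂_of_le (f := fun (i : ℤ) (_ : i ≤ j) =>
    MeasurableSpace.comap (X i) inferInstance) i h le_rfl)

theorem measurable_futureSigma {Ω : Type*} {X : ℤ → Ω → ℝ} {i j : ℤ} (h : j ≤ i) : Measurable[futureSigma X j] (X i) :=
  measurable_iff_comap_le.2 (le_iSup₂_of_le (f := fun (i : ℤ) (_ : j ≤ i) =>
    MeasurableSpace.comap (X i) inferInstance) i h le_rfl)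

theorem measure_inter_le_psiStar [IsFiniteMeasure μ] (g j : ℕ) (A B : Set Ω)
    (hA : MeasurableSet[pastSigma X j] A) (hB : MeasurableSet[futureSigma X (j + g)] B) :
    μ (A ∩ B) ≤ psiStar X μ g * (μ A * μ B) := by
  by_cases h : 0 < μ A * μ B
  · have : μ (A ∩ B) / (μ A * μ B) ≤ psiStar X μ g :=
      le_iSup_of_le j <| le_iSup_of_le A <| le_iSup_of_le B <| le_iSup_of_le hA <|
        le_iSup_of_le hB <| le_iSup_of_le h le_rfl
    rwa [ENNReal.div_le_iff h.ne' (ENNReal.mul_ne_top (measure_ne_top _ _) (measure_ne_top _ _))]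
      at this
  · rw [not_lt, nonpos_iff_eq_zero, mul_eq_zero] at h
    rcases h with h | h
    · rw [measure_mono_null Set.inter_subset_left h]; exact zero_le
    · rw [measure_mono_null Set.inter_subset_right h]; exact zero_le

/-- For a fixed future event `B`, the bound for events is an inequality between measures on the past
σ-field, hence passes to integrals of `Y` over `B`. As `B` varies, this is an inequality between
measures on the future σ-field, one of them with density `Y`, hence passes to integrals of `Z`. -/
theorem lintegral_mul_le_psiStar [IsFiniteMeasure μ] (hX : ∀ i, Measurable (X i)) (g j : ℕ)
    (Y Z : Ω → ℝ≥0∞) (hY : Measurable[pastSigma X j] Y)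
    (hZ : Measurable[futureSigma X (j + g)] Z) :
    ∫⁻ ω, Y ω * Z ω ∂μ ≤ psiStar X μ g * ((∫⁻ ω, Y ω ∂μ) * ∫⁻ ω, Z ω ∂μ) := by
  have hp := pastSigma_le (X := X) hX j
  have hf := futureSigma_le (X := X) hX (j + g)
  have h1 : ∀ B, MeasurableSet[futureSigma X (j + g)] B →
      ∫⁻ ω in B, Y ω ∂μ ≤ (psiStar X μ g * μ B) * ∫⁻ ω, Y ω ∂μ := by
    intro B hB
    have hle : (μ.restrict B).trim hp ≤ (psiStar X μ g * μ B) • μ.trim hp := by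
      refine (@Measure.le_iff Ω (pastSigma X j) _ _).2 fun A hA => ?_
      rw [trim_measurableSet_eq hp hA, Measure.restrict_apply (hp _ hA), Measure.smul_apply,
        trim_measurableSet_eq hp hA, smul_eq_mul, mul_assoc, mul_comm (μ B)]
      exact measure_inter_le_psiStar g j A B hA hB
    rw [← lintegral_trim hp hY]
    refine (lintegral_mono' hle le_rfl).trans ?_
    rw [lintegral_smul_measure, lintegral_trim hp hY, smul_eq_mul]
  have hle : (μ.withDensity Y).trim hf ≤ (psiStar X μ g * ∫⁻ ω, Y ω ∂μ) • μ.trim hf := by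
    refine (@Measure.le_iff Ω (futureSigma X (j + g)) _ _).2 fun B hB => ?_
    rw [trim_measurableSet_eq hf hB, withDensity_apply _ (hf _ hB), Measure.smul_apply,
      trim_measurableSet_eq hf hB, smul_eq_mul, mul_right_comm]
    exact h1 B hB
  calc ∫⁻ ω, Y ω * Z ω ∂μ = ∫⁻ ω, Z ω ∂(μ.withDensity Y) := by
        rw [lintegral_withDensity_eq_lintegral_mul _ (hY.mono hp le_rfl) (hZ.mono hf le_rfl)]
        rfl
    _ = ∫⁻ ω, Z ω ∂(μ.withDensity Y).trim hf := (lintegral_trim hf hZ).symm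
    _ ≤ ∫⁻ ω, Z ω ∂((psiStar X μ g * ∫⁻ ω, Y ω ∂μ) • μ.trim hf) := lintegral_mono' hle le_rfl
    _ = _ := by rw [lintegral_smul_measure, lintegral_trim hf hZ, smul_eq_mul, mul_assoc]

end

section

variable {Ω : Type*} [MeasurableSpace Ω] {X : ℤ → Ω → ℝ} {μ : Measure Ω}

/-! ### The integer part has finite entropy -/

/-- The probability that `X₁` has the same integer part as `x`. -/
def floorProb (X : ℤ → Ω → ℝ) (μ : Measure Ω) (x : ℝ) : ℝ := μ.real {ω | ⌊X 1 ω⌋ = ⌊x⌋}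

theorem floorProb_quantize (b : ℕ) (x : ℝ) : floorProb X μ (quantize b x) = floorProb X μ x := by
  unfold floorProb
  rw [floor_quantize]

theorem measurable_floorProb : Measurable (floorProb X μ) :=
  (measurable_of_countable fun z : ℤ => μ.real {ω | ⌊X 1 ω⌋ = z}).comp measurable_id.floor

theorem lintegral_eq_of_isStationary (hX : ∀ i, Measurable (X i)) (hstat : IsStationary X μ)
    (F : ℝ → ℝ≥0∞) (hF : Measurable F) (i : ℤ) :
    ∫⁻ ω, F (X i ω) ∂μ = ∫⁻ ω, F (X 1 ω) ∂μ := by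
  have h := lintegral_shiftedBlock hX hstat 1 (i - 1) (fun x => F (x 0))
    (hF.comp (measurable_pi_apply _))
  simpa [shiftedBlock, initialBlock] using h

theorem measureReal_floor_eq (hX : ∀ i, Measurable (X i)) (hstat : IsStationary X μ) (i : ℤ)
    (x : ℝ) : μ.real {ω | ⌊X i ω⌋ = ⌊x⌋} = floorProb X μ x := by
  classical
  have hs : MeasurableSet {y : ℝ | ⌊y⌋ = ⌊x⌋} :=
    measurable_id.floor (measurableSet_singleton _)
  have h := lintegral_eq_of_isStationary hX hstat ({y : ℝ | ⌊y⌋ = ⌊x⌋}.indicator 1)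
    (measurable_one.indicator hs) i
  have e : ∀ j, ∫⁻ ω, ({y : ℝ | ⌊y⌋ = ⌊x⌋}.indicator (1 : ℝ → ℝ≥0∞)) (X j ω) ∂μ =
      μ {ω | ⌊X j ω⌋ = ⌊x⌋} := by
    intro j
    exact lintegral_indicator_one (hX j hs)
  rw [e, e] at h
  rw [floorProb, measureReal_def, measureReal_def, h]

theorem measurableSet_quantize_block_eq (hX : ∀ i, Measurable (X i)) (b K : ℕ) (a : Fin K → ℝ) :
    MeasurableSet {ω | ∀ i, quantize b (initialBlock X K ω i) = a i} := by
  rw [Set.ofPred_forall]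
  exact MeasurableSet.iInter fun i => (measurable_quantize b).comp (hX _) (measurableSet_singleton _)

theorem blockProb_succ_le [IsProbabilityMeasure μ] (b k : ℕ) (a : Fin (k + 1) → ℝ) :
    blockProb X μ b (k + 1) a ≤ blockProb X μ b k (Fin.init a) := by
  refine measureReal_mono fun ω hω i => ?_
  simpa [initialBlock, Fin.init] using hω i.castSucc

theorem condInfo_nonneg [IsProbabilityMeasure μ] (b k : ℕ) (a : Fin (k + 1) → ℝ) :
    0 ≤ condInfo X μ b k a := by
  rw [condInfo, neg_nonneg]
  apply Real.logb_nonpos one_lt_two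
  · exact div_nonneg measureReal_nonneg measureReal_nonneg
  · exact div_le_one_of_le₀ (blockProb_succ_le b k a) measureReal_nonneg

/-- The quantized prefix `[X^k]_b`. -/
def quantPrefix {Ω : Type*} (X : ℤ → Ω → ℝ) (b k : ℕ) (ω : Ω) : Fin k → ℝ :=
  fun i => quantize b (initialBlock X k ω i)

theorem init_quantPrefix {Ω : Type*} {X : ℤ → Ω → ℝ} (b k : ℕ) (ω : Ω) :
    Fin.init (quantPrefix X b (k + 1) ω) = quantPrefix X b k ω := by
  funext i
  simp [Fin.init, quantPrefix, initialBlock]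

theorem sum_condInfo_eq (b k g : ℕ) (ω : Ω)
    (h : ∀ j, 0 < blockProb X μ b j (quantPrefix X b j ω)) :
    ∑ j ∈ Finset.range g, condInfo X μ b (k + j) (quantPrefix X b (k + j + 1) ω) =
      Real.logb 2 (blockProb X μ b k (quantPrefix X b k ω)) -
      Real.logb 2 (blockProb X μ b (k + g) (quantPrefix X b (k + g) ω)) := by
  induction g with
  | zero => simp
  | succ g ih =>
    rw [Finset.sum_range_succ, ih, condInfo, init_quantPrefix,
      Real.logb_div (h _).ne' (h _).ne', ← add_assoc]
    ring

/-- The integer part of a mixing source has finite entropy as soon as the conditional entropies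
of sufficiently many orders are finite. -/
theorem lintegral_floorProb_lt_top [IsProbabilityMeasure μ] (hX : ∀ i, Measurable (X i))
    (hstat : IsStationary X μ) (b k g : ℕ) (hg : 0 < g) (hpsi : psiStar X μ g ≤ 2)
    (hH : ∀ j < g, condEntropy X μ b (k + j) ≠ ∞) :
    ∫⁻ ω, ENNReal.ofReal (-Real.logb 2 (floorProb X μ (X 1 ω))) ∂μ < ∞ := by
  rw [← lintegral_eq_of_isStationary hX hstat
    (fun x => ENNReal.ofReal (-Real.logb 2 (floorProb X μ x)))
    (measurable_floorProb.log.div_const _).neg.ennreal_ofReal (k + g : ℤ)]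
  have hpos : ∀ᵐ ω ∂μ, ∀ j, 0 < blockProb X μ b j (quantPrefix X b j ω) :=
    ae_all_iff.2 fun j => ae_blockProb_pos hX b j
  -- By the chain rule the conditional self-informations add up to `log p - log p'`, where `p` and
  -- `p'` are the probabilities of the observed blocks of lengths `k` and `k + g`. Mixing across the
  -- gap `g` gives `p' ≤ 2 p · floorProb`, so this sum is at least `-log floorProb - 1`.
  have hle : ∀ᵐ ω ∂μ, ENNReal.ofReal (-Real.logb 2 (floorProb X μ (X (k + g : ℤ) ω))) ≤
      1 + ∑ j ∈ Finset.range g,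
        ENNReal.ofReal (condInfo X μ b (k + j) (quantPrefix X b (k + j + 1) ω)) := by
    filter_upwards [hpos] with ω hω
    rw [← ENNReal.ofReal_sum_of_nonneg fun j _ => condInfo_nonneg _ _ _, ← ENNReal.ofReal_one,
      ← ENNReal.ofReal_add zero_le_one (Finset.sum_nonneg fun j _ => condInfo_nonneg _ _ _)]
    apply ENNReal.ofReal_le_ofReal
    rw [sum_condInfo_eq b k g ω hω]
    set p := blockProb X μ b k (quantPrefix X b k ω)
    set p' := blockProb X μ b (k + g) (quantPrefix X b (k + g) ω)
    have hmix : p' ≤ 2 * (p * floorProb X μ (X (k + g : ℤ) ω)) := by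
      set A := {ω' | ∀ i, quantize b (initialBlock X k ω' i) = quantPrefix X b k ω i}
      set B := {ω' | ⌊X (k + g : ℤ) ω'⌋ = ⌊X (k + g : ℤ) ω⌋}
      have hA : MeasurableSet[pastSigma X k] A := by
        have : A = ⋂ i : Fin k, X (i + 1) ⁻¹' (quantize b ⁻¹' {quantPrefix X b k ω i}) := by
          ext ω'; simp [A, initialBlock]
        rw [this]
        refine @MeasurableSet.iInter _ _ (pastSigma X k) _ _ fun i => ?_
        exact measurable_pastSigma (by have := i.2; omega)
          (measurable_quantize b (measurableSet_singleton _))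
      have hB : MeasurableSet[futureSigma X (k + g)] B :=
        measurable_futureSigma (le_refl (k + g : ℤ))
          (measurable_id.floor (measurableSet_singleton _) :
            MeasurableSet {y : ℝ | ⌊y⌋ = ⌊X (k + g : ℤ) ω⌋})
      have h1 := (measure_inter_le_psiStar (μ := μ) g k A B hA hB).trans
        (mul_le_mul_left hpsi _)
      have h2 : p' ≤ μ.real (A ∩ B) := by
        refine measureReal_mono fun ω' hω' => ⟨fun i => ?_, ?_⟩
        · exact hω' (Fin.castAdd g i)
        -- Coordinates count from 0 and samples from 1, so this is the sample `X_{k+g}`.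
        · have := hω' ⟨k + g - 1, by omega⟩
          have h3 := congrArg Int.floor this
          simp only [quantPrefix, floor_quantize, initialBlock] at h3
          have e : (((k + g - 1 : ℕ) : ℤ) + 1) = (k + g : ℤ) := by omega
          rw [e] at h3
          exact h3
      refine h2.trans ?_
      rw [← measureReal_floor_eq hX hstat (k + g : ℤ)]
      have := ENNReal.toReal_mono (by finiteness) h1
      simp only [ENNReal.toReal_mul, ENNReal.toReal_ofNat] at this
      exact this
    have hp : 0 < p := hω k
    have hp' : 0 < p' := hω (k + g)
    have hf : 0 < floorProb X μ (X (k + g : ℤ) ω) := by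
      by_contra hc
      have : p * floorProb X μ (X (k + g : ℤ) ω) ≤ 0 :=
        mul_nonpos_of_nonneg_of_nonpos hp.le (not_lt.1 hc)
      linarith
    have h4 := Real.logb_le_logb_of_le one_lt_two hp' hmix
    rw [Real.logb_mul two_ne_zero (by positivity), Real.logb_mul hp.ne' hf.ne',
      Real.logb_self_eq_one one_lt_two] at h4
    linarith
  refine (lintegral_mono_ae hle).trans_lt ?_
  have hm : ∀ j, Measurable fun ω =>
      ENNReal.ofReal (condInfo X μ b (k + j) (quantPrefix X b (k + j + 1) ω)) := fun j =>
    ((measurable_comp_quantize b (k + j + 1) (condInfo X μ b (k + j))).comp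
      (measurable_initialBlock hX _)).ennreal_ofReal
  rw [lintegral_add_left measurable_const, lintegral_finsetSum _ fun j _ => hm j]
  simp only [lintegral_const, measure_univ, mul_one, ENNReal.add_lt_top, ENNReal.one_lt_top,
    true_and, ENNReal.sum_lt_top]
  intro j hj
  refine (lintegral_condInfo_le hX b (k + j)).trans_lt (lt_top_iff_ne_top.2 ?_)
  exact hH j (by simpa using hj)

end

section

variable {Ω : Type*} [MeasurableSpace Ω] {X : ℤ → Ω → ℝ} {μ : Measure Ω}

/-! ### A conditional model with bounded code length -/

/-- The mixture of the conditional law of `[X_{k+1}]_b` given `[X^k]_b` with the law that is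
uniform on the `2^b` grid points in each unit interval. -/
def modelProb (X : ℤ → Ω → ℝ) (μ : Measure Ω) (b k : ℕ) (a : Fin (k + 1) → ℝ) : ℝ :=
  blockProb X μ b (k + 1) a / blockProb X μ b k (Fin.init a) / 2 +
    floorProb X μ (a (Fin.last k)) / 2 ^ b / 2

theorem modelProb_nonneg (b k : ℕ) (a : Fin (k + 1) → ℝ) : 0 ≤ modelProb X μ b k a := by
  have h1 : 0 ≤ blockProb X μ b (k + 1) a := measureReal_nonneg
  have h2 : 0 ≤ blockProb X μ b k (Fin.init a) := measureReal_nonneg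
  have h3 : 0 ≤ floorProb X μ (a (Fin.last k)) := measureReal_nonneg
  unfold modelProb
  positivity

theorem modelProb_le_one [IsProbabilityMeasure μ] (b k : ℕ) (a : Fin (k + 1) → ℝ) :
    modelProb X μ b k a ≤ 1 := by
  have h1 : blockProb X μ b (k + 1) a / blockProb X μ b k (Fin.init a) ≤ 1 :=
    div_le_one_of_le₀ (blockProb_succ_le b k a) measureReal_nonneg
  have h2 : floorProb X μ (a (Fin.last k)) / 2 ^ b ≤ 1 := by
    apply div_le_one_of_le₀ _ (by positivity)
    exact measureReal_le_one.trans (one_le_pow₀ one_le_two)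
  unfold modelProb
  linarith

theorem sum_measureReal_inter_preimage_le [IsFiniteMeasure μ] {β : Type*} (f : Ω → β) (A : Set Ω)
    (hA : ∀ z, MeasurableSet (A ∩ {ω | f ω = z})) (F : Finset β) :
    ∑ z ∈ F, μ.real (A ∩ {ω | f ω = z}) ≤ μ.real A := by
  rw [← measureReal_biUnion_finset]
  · exact measureReal_mono (Set.iUnion₂_subset fun _ _ => Set.inter_subset_left)
  · intro z _ z' _ hzz'
    refine Set.disjoint_left.2 fun ω h h' => hzz' ?_
    exact h.2.symm.trans h'.2
  · exact fun z _ => hA z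

theorem sum_blockProb_snoc_le [IsFiniteMeasure μ] (hX : ∀ i, Measurable (X i)) (b k : ℕ)
    (y : Fin k → ℝ) (C : Finset ℝ) :
    ∑ c ∈ C, blockProb X μ b (k + 1) (Fin.snoc (α := fun _ => ℝ) y c) ≤ blockProb X μ b k y := by
  set A := {ω | ∀ i, quantize b (initialBlock X k ω i) = y i}
  set f : Ω → ℝ := fun ω => quantize b (X (k + 1) ω)
  have e : ∀ c, {ω | ∀ i, quantize b (initialBlock X (k + 1) ω i) =
      (Fin.snoc (α := fun _ => ℝ) y c : Fin (k + 1) → ℝ) i} = A ∩ {ω | f ω = c} := by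
    intro c
    ext ω
    simp only [Set.mem_ofPred_eq, Fin.forall_fin_succ', Fin.snoc_castSucc, Fin.snoc_last,
      Set.mem_inter_iff, A, f]
    rfl
  simp only [blockProb, e]
  refine sum_measureReal_inter_preimage_le f A (fun z => ?_) C
  exact (measurableSet_quantize_block_eq hX b k y).inter
    (((measurable_quantize b).comp (hX _)) (measurableSet_singleton z))

theorem card_filter_floor_eq_le (b : ℕ) (C : Finset ℝ) (hC : ∀ c ∈ C, c ∈ Set.range (gridPoint b))
    (z : ℤ) : (C.filter fun c => ⌊c⌋ = z).card ≤ 2 ^ b := by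
  classical
  have : C.filter (fun c => ⌊c⌋ = z) ⊆
      (Finset.Ico (z * 2 ^ b) ((z + 1) * 2 ^ b)).image (gridPoint b) := by
    intro c hc
    obtain ⟨hc1, hc2⟩ := Finset.mem_filter.1 hc
    obtain ⟨i, rfl⟩ := hC c hc1
    refine Finset.mem_image_of_mem _ (Finset.mem_Ico.2 ?_)
    rw [Int.floor_eq_iff, gridPoint, le_div_iff₀ (by positivity), div_lt_iff₀ (by positivity)] at hc2
    exact ⟨by exact_mod_cast hc2.1, by exact_mod_cast hc2.2⟩
  refine (Finset.card_le_card this).trans (Finset.card_image_le.trans ?_)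
  rw [Int.card_Ico]
  have : (z + 1) * 2 ^ b - z * 2 ^ b = ((2 ^ b : ℕ) : ℤ) := by push_cast; ring
  rw [this, Int.toNat_natCast]

/-- The probability of each unit cell is counted once for each of its at most `2 ^ b` grid points;
hence the division by `2 ^ b` in `modelProb`. -/
theorem sum_floorProb_le [IsProbabilityMeasure μ] (hX : ∀ i, Measurable (X i)) (b : ℕ)
    (C : Finset ℝ) (hC : ∀ c ∈ C, c ∈ Set.range (gridPoint b)) :
    ∑ c ∈ C, floorProb X μ c ≤ 2 ^ b := by
  classical
  have h1 : ∑ c ∈ C, floorProb X μ c =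
      ∑ z ∈ C.image Int.floor, (C.filter fun c => ⌊c⌋ = z).card • μ.real {ω | ⌊X 1 ω⌋ = z} :=
    Finset.sum_comp (fun z : ℤ => μ.real {ω | ⌊X 1 ω⌋ = z}) Int.floor
  have h2 : ∑ z ∈ C.image Int.floor, μ.real {ω | ⌊X 1 ω⌋ = z} ≤ 1 := by
    have := sum_measureReal_inter_preimage_le (μ := μ) (fun ω => ⌊X 1 ω⌋) Set.univ
      (fun z => MeasurableSet.univ.inter ((hX 1).floor (measurableSet_singleton z)))
      (C.image Int.floor)
    simpa using this
  rw [h1]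
  calc _ ≤ ∑ z ∈ C.image Int.floor, (2 : ℝ) ^ b * μ.real {ω | ⌊X 1 ω⌋ = z} := by
        refine Finset.sum_le_sum fun z _ => ?_
        rw [nsmul_eq_mul]
        refine mul_le_mul_of_nonneg_right ?_ measureReal_nonneg
        exact_mod_cast card_filter_floor_eq_le b C hC z
    _ ≤ 2 ^ b := by
        rw [← Finset.mul_sum]
        exact mul_le_of_le_one_right (by positivity) h2

theorem sum_modelProb_le_one [IsProbabilityMeasure μ] (hX : ∀ i, Measurable (X i)) (b k : ℕ)
    (y : Fin k → ℝ) (C : Finset ℝ) (hC : ∀ c ∈ C, c ∈ Set.range (gridPoint b)) :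
    ∑ c ∈ C, modelProb X μ b k (Fin.snoc (α := fun _ => ℝ) y c) ≤ 1 := by
  simp only [modelProb, Fin.init_snoc, Fin.snoc_last]
  rw [Finset.sum_add_distrib, ← Finset.sum_div, ← Finset.sum_div, ← Finset.sum_div,
    ← Finset.sum_div]
  have h1 := div_le_one_of_le₀ (sum_blockProb_snoc_le (μ := μ) hX b k y C) measureReal_nonneg
  have h2 := div_le_one_of_le₀ (sum_floorProb_le (μ := μ) hX b C hC) (by positivity)
  linarith

/-- The ideal code length of a letter under the model. -/
def codeLength (X : ℤ → Ω → ℝ) (μ : Measure Ω) (b k : ℕ) (a : Fin (k + 1) → ℝ) : ℝ :=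
  -Real.logb 2 (modelProb X μ b k a)

theorem codeLength_nonneg [IsProbabilityMeasure μ] (b k : ℕ) (a : Fin (k + 1) → ℝ) :
    0 ≤ codeLength X μ b k a :=
  neg_nonneg.2 (Real.logb_nonpos one_lt_two (modelProb_nonneg b k a) (modelProb_le_one b k a))

theorem blockProb_le_floorProb [IsProbabilityMeasure μ] (hX : ∀ i, Measurable (X i))
    (hstat : IsStationary X μ) (b k : ℕ) (a : Fin (k + 1) → ℝ) :
    blockProb X μ b (k + 1) a ≤ floorProb X μ (a (Fin.last k)) := by
  rw [← measureReal_floor_eq hX hstat (k + 1 : ℤ)]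
  refine measureReal_mono fun ω hω => ?_
  have h := congrArg Int.floor (hω (Fin.last k))
  rw [floor_quantize] at h
  exact h

theorem modelProb_pos [IsProbabilityMeasure μ] (b k : ℕ) (a : Fin (k + 1) → ℝ)
    (ha : 0 < blockProb X μ b (k + 1) a) : 0 < modelProb X μ b k a := by
  have h1 := ha.trans_le (blockProb_succ_le b k a)
  have h2 : 0 ≤ floorProb X μ (a (Fin.last k)) := measureReal_nonneg
  unfold modelProb
  positivity

/-- The first mixture component alone, at the price of one bit. This controls the mean code length
by the conditional entropy. -/
theorem codeLength_le_condInfo [IsProbabilityMeasure μ] (b k : ℕ) (a : Fin (k + 1) → ℝ)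
    (ha : 0 < blockProb X μ b (k + 1) a) :
    codeLength X μ b k a ≤ 1 + condInfo X μ b k a := by
  have h1 := ha.trans_le (blockProb_succ_le b k a)
  have h2 : 0 ≤ floorProb X μ (a (Fin.last k)) := measureReal_nonneg
  have h3 : blockProb X μ b (k + 1) a / blockProb X μ b k (Fin.init a) / 2 ≤
      modelProb X μ b k a := le_add_of_nonneg_right (by positivity)
  have h4 := Real.logb_le_logb_of_le one_lt_two (by positivity) h3
  rw [Real.logb_div (by positivity) two_ne_zero, Real.logb_self_eq_one one_lt_two] at h4
  unfold codeLength condInfo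
  linarith

/-- The second mixture component alone. The bound splits into the constant `1 + b` and a term that
involves only the integer part, whose law does not depend on `b`; this is what makes truncation at a
level of order `b` possible. -/
theorem codeLength_le_floorProb [IsProbabilityMeasure μ] (hX : ∀ i, Measurable (X i))
    (hstat : IsStationary X μ) (b k : ℕ) (a : Fin (k + 1) → ℝ)
    (ha : 0 < blockProb X μ b (k + 1) a) :
    codeLength X μ b k a ≤ 1 + b - Real.logb 2 (floorProb X μ (a (Fin.last k))) := by
  have h1 := ha.trans_le (blockProb_succ_le b k a)
  have h2 := ha.trans_le (blockProb_le_floorProb hX hstat b k a)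
  have h3 : floorProb X μ (a (Fin.last k)) / 2 ^ b / 2 ≤ modelProb X μ b k a :=
    le_add_of_nonneg_left (by positivity)
  have h4 := Real.logb_le_logb_of_le one_lt_two (by positivity) h3
  rw [Real.logb_div (by positivity) two_ne_zero, Real.logb_self_eq_one one_lt_two,
    Real.logb_div (by positivity) (by positivity), Real.logb_pow,
    Real.logb_self_eq_one one_lt_two] at h4
  unfold codeLength
  linarith

/-! ### A weak law of large numbers -/

/-- Chebyshev's inequality for the sum of bounded nonnegative variables whose distant pairs are
almost uncorrelated. -/
theorem measureReal_sum_ge_le [IsProbabilityMeasure μ] (M G : ℕ) (hM : 0 < M) (W : ℕ → Ω → ℝ)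
    (B e κ η : ℝ) (hη : 0 < η) (hκ : 0 ≤ κ) (hW : ∀ s, Measurable (W s)) (h0 : ∀ s ω, 0 ≤ W s ω)
    (hB : ∀ s ω, W s ω ≤ B) (he : ∀ s, ∫ ω, W s ω ∂μ = e)
    (hcorr : ∀ s s', s + G ≤ s' → ∫ ω, W s ω * W s' ω ∂μ ≤ (1 + κ) * e ^ 2) :
    μ.real {ω | M * (e + η) ≤ ∑ s ∈ Finset.range M, W s ω} ≤
      ((2 * G + 1) * B ^ 2 / M + κ * e ^ 2) / η ^ 2 := by
  have hMpos : (0 : ℝ) < M := by exact_mod_cast hM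
  have hL2 : ∀ s, MemLp (W s) 2 μ := fun s =>
    MemLp.of_bound (hW s).aestronglyMeasurable B
      (ae_of_all _ fun ω => by rw [Real.norm_of_nonneg (h0 s ω)]; exact hB s ω)
  have hI : ∀ s, Integrable (W s) μ := fun s => (hL2 s).integrable one_le_two
  have hII : ∀ s s', Integrable (fun ω => W s ω * W s' ω) μ := fun s s' =>
    (hL2 s).integrable_mul (hL2 s')
  set S : Ω → ℝ := fun ω => ∑ s ∈ Finset.range M, W s ω with hS
  have hSL2 : MemLp S 2 μ := memLp_finsetSum _ fun s _ => hL2 s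
  have hES : ∫ ω, S ω ∂μ = M * e := by
    rw [integral_finsetSum _ fun s _ => hI s]
    simp [he]
  have hsym : ∀ s s', s + G ≤ s' ∨ s' + G ≤ s →
      ∫ ω, W s ω * W s' ω ∂μ ≤ (1 + κ) * e ^ 2 := by
    rintro s s' (h | h)
    · exact hcorr s s' h
    · simp only [mul_comm (W s _)]
      exact hcorr s' s h
  -- Every pair is charged the mixing bound; the at most `2 G + 1` partners near `s` are charged an
  -- additional trivial `B ^ 2`.
  have hpair : ∀ s s', ∫ ω, W s ω * W s' ω ∂μ ≤
      (if s' ∈ Finset.Icc (s - G) (s + G) then B ^ 2 else 0) + (1 + κ) * e ^ 2 := by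
    intro s s'
    by_cases h : s' ∈ Finset.Icc (s - G) (s + G)
    · rw [if_pos h]
      have h1 : ∫ ω, W s ω * W s' ω ∂μ ≤ ∫ _, B ^ 2 ∂μ := by
        refine integral_mono (hII s s') (integrable_const _) fun ω => ?_
        rw [sq]
        exact mul_le_mul (hB s ω) (hB s' ω) (h0 s' ω) ((h0 s ω).trans (hB s ω))
      simp only [integral_const, probReal_univ, one_smul] at h1
      have : 0 ≤ (1 + κ) * e ^ 2 := by positivity
      linarith
    · rw [if_neg h, zero_add]
      apply hsym
      rw [Finset.mem_Icc] at h
      omega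
  have hS2 : ∫ ω, S ω ^ 2 ∂μ ≤ M * ((2 * G + 1) * B ^ 2) + M ^ 2 * ((1 + κ) * e ^ 2) := by
    have e1 : ∀ ω, S ω ^ 2 = ∑ s ∈ Finset.range M, ∑ s' ∈ Finset.range M, W s ω * W s' ω := by
      intro ω
      rw [sq, hS, Finset.sum_mul_sum]
    simp only [e1]
    rw [integral_finsetSum _ fun s _ => integrable_finsetSum _ fun s' _ => hII s s']
    calc _ ≤ ∑ s ∈ Finset.range M, ((2 * G + 1) * B ^ 2 + M * ((1 + κ) * e ^ 2)) := by
          refine Finset.sum_le_sum fun s _ => ?_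
          rw [integral_finsetSum _ fun s' _ => hII s s']
          refine (Finset.sum_le_sum fun s' _ => hpair s s').trans ?_
          rw [Finset.sum_add_distrib, ← Finset.sum_filter]
          simp only [Finset.sum_const, Finset.card_range, nsmul_eq_mul]
          gcongr
          have : ((Finset.range M).filter fun s' => s' ∈ Finset.Icc (s - G) (s + G)).card ≤
              2 * G + 1 := by
            refine (Finset.card_le_card (t := Finset.Icc (s - G) (s + G)) ?_).trans ?_
            · intro s' hs'
              exact (Finset.mem_filter.1 hs').2
            · rw [Nat.card_Icc]; omega
          exact_mod_cast this
      _ = _ := by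
          simp only [Finset.sum_const, Finset.card_range, nsmul_eq_mul]
          ring
  have hvar : Var[S; μ] ≤ M * ((2 * G + 1) * B ^ 2) + M ^ 2 * (κ * e ^ 2) := by
    rw [variance_eq_sub hSL2, hES]
    have : ∫ ω, (S ^ 2) ω ∂μ = ∫ ω, S ω ^ 2 ∂μ := rfl
    rw [this]
    nlinarith
  have hcheb := meas_ge_le_variance_div_sq hSL2 (c := M * η) (by positivity)
  have hsub : {ω | M * (e + η) ≤ S ω} ⊆ {ω | M * η ≤ |S ω - μ[S]|} := by
    intro ω hω
    simp only [Set.mem_ofPred_eq] at hω ⊢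
    rw [hES]
    exact le_trans (by linarith) (le_abs_self _)
  calc μ.real {ω | M * (e + η) ≤ S ω} ≤ Var[S; μ] / (M * η) ^ 2 := by
        have h := (measure_mono hsub).trans hcheb
        have := ENNReal.toReal_mono ENNReal.ofReal_ne_top h
        rwa [ENNReal.toReal_ofReal (div_nonneg (variance_nonneg _ _) (sq_nonneg _))] at this
    _ ≤ (M * ((2 * G + 1) * B ^ 2) + M ^ 2 * (κ * e ^ 2)) / (M * η) ^ 2 := by gcongr
    _ = _ := by field_simp

end

section

variable {Ω : Type*} [MeasurableSpace Ω] {X : ℤ → Ω → ℝ} {μ : Measure Ω}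

/-! ### Concentration of the code length and of the empirical conditional entropy -/

theorem exists_lintegral_sub_le (h : Ω → ℝ) (hm : Measurable h)
    (hfin : ∫⁻ ω, ENNReal.ofReal (h ω) ∂μ < ∞) (ρ : ℝ≥0∞) (hρ : 0 < ρ) :
    ∃ T : ℕ, ∫⁻ ω, ENNReal.ofReal (h ω - T) ∂μ ≤ ρ := by
  have ht : Tendsto (fun T : ℕ => ∫⁻ ω, ENNReal.ofReal (h ω - T) ∂μ) atTop
      (𝓝 (∫⁻ _, 0 ∂μ)) := by
    refine tendsto_lintegral_of_dominated_convergence (fun ω => ENNReal.ofReal (h ω))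
      (fun T => (hm.sub_const _).ennreal_ofReal) (fun T => ae_of_all _ fun ω => ?_) hfin.ne
      (ae_of_all _ fun ω => ?_)
    · exact ENNReal.ofReal_le_ofReal (by simp)
    · refine tendsto_const_nhds.congr' ?_
      filter_upwards [eventually_ge_atTop ⌈h ω⌉₊] with T hT
      refine (ENNReal.ofReal_of_nonpos ?_).symm
      exact sub_nonpos.2 ((Nat.le_ceil _).trans (by exact_mod_cast hT))
  rw [lintegral_zero] at ht
  exact ((ht.eventually (ge_mem_nhds hρ)).exists)

/-- The coefficient `ψ*` bounds correlations from above only, which is enough to bound a second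
moment. -/
theorem integral_mul_shiftedBlock_le [IsProbabilityMeasure μ] (hX : ∀ i, Measurable (X i))
    (hstat : IsStationary X μ) (K G : ℕ) (κ : ℝ) (hκ : 0 ≤ κ)
    (hG : ∀ g, G ≤ g → psiStar X μ g ≤ ENNReal.ofReal (1 + κ)) (F : (Fin K → ℝ) → ℝ)
    (hF : Measurable F) (hF0 : ∀ x, 0 ≤ F x) (B : ℝ) (hFB : ∀ x, F x ≤ B) (t t' : ℕ)
    (h : t + (G + K) ≤ t') :
    ∫ ω, F (shiftedBlock X K t ω) * F (shiftedBlock X K t' ω) ∂μ ≤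
      (1 + κ) * (∫ ω, F (initialBlock X K ω) ∂μ) ^ 2 := by
  have hY : Measurable[pastSigma X ((t + K : ℕ) : ℤ)]
      fun ω => ENNReal.ofReal (F (shiftedBlock X K t ω)) := by
    refine (ENNReal.measurable_ofReal.comp hF).comp ?_
    refine @measurable_pi_lambda _ _ _ (pastSigma X ((t + K : ℕ) : ℤ)) _ _ fun i => ?_
    exact measurable_pastSigma (by have := i.2; push_cast; omega)
  obtain ⟨g, hg⟩ : ∃ g, t' = t + K + g := ⟨t' - (t + K), by omega⟩
  have hZ : Measurable[futureSigma X (((t + K : ℕ) : ℤ) + g)]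
      fun ω => ENNReal.ofReal (F (shiftedBlock X K t' ω)) := by
    refine (ENNReal.measurable_ofReal.comp hF).comp ?_
    refine @measurable_pi_lambda _ _ _ (futureSigma X (((t + K : ℕ) : ℤ) + g)) _ _ fun i => ?_
    exact measurable_futureSigma (by rw [hg]; push_cast; omega)
  have h1 := lintegral_mul_le_psiStar (μ := μ) hX g (t + K) _ _ hY hZ
  rw [lintegral_shiftedBlock hX hstat K t (fun x => ENNReal.ofReal (F x)) hF.ennreal_ofReal,
    lintegral_shiftedBlock hX hstat K t' (fun x => ENNReal.ofReal (F x)) hF.ennreal_ofReal] at h1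
  have hi : Integrable (fun ω => F (initialBlock X K ω)) μ :=
    Integrable.of_bound (hF.comp (measurable_initialBlock hX K)).aestronglyMeasurable B
      (ae_of_all _ fun ω => by
        change ‖F _‖ ≤ B
        rw [Real.norm_of_nonneg (hF0 _)]; exact hFB _)
  rw [← ofReal_integral_eq_lintegral_ofReal hi (ae_of_all _ fun ω => hF0 _)] at h1
  have h2 := h1.trans (mul_le_mul_left (hG g (by omega)) _)
  have he : 0 ≤ ∫ ω, F (initialBlock X K ω) ∂μ := integral_nonneg fun ω => hF0 _
  rw [← ENNReal.ofReal_mul he, ← ENNReal.ofReal_mul (by positivity), ← sq] at h2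
  simp only [← ENNReal.ofReal_mul (hF0 _)] at h2
  rw [integral_eq_lintegral_of_nonneg_ae (ae_of_all _ fun ω => mul_nonneg (hF0 _) (hF0 _))
    (((hF.comp (measurable_shiftedBlock hX K t)).mul
      (hF.comp (measurable_shiftedBlock hX K t'))).aestronglyMeasurable)]
  have h3 := ENNReal.toReal_mono ENNReal.ofReal_ne_top h2
  rwa [ENNReal.toReal_ofReal (by positivity)] at h3

/-- The code length is truncated at `B = 1 + b + T`. The truncated part is bounded by a multiple of
`b` and has mean at most `1 + D b`, so Chebyshev's inequality at scale `b` works uniformly in `b`.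
The excess over `B` is at most `(-log floorProb - T)⁺`, whose mean is small uniformly in `b`, and
Markov's inequality keeps its sum below `M`. The thresholds for `b` and `M` are separate and do not
involve `t`, so `b` may grow with `n`. -/
theorem codeLength_concentration [IsProbabilityMeasure μ] (hX : ∀ i, Measurable (X i))
    (hstat : IsStationary X μ) (hmix : IsPsiStarMixing X μ)
    (hfin : ∫⁻ ω, ENNReal.ofReal (-Real.logb 2 (floorProb X μ (X 1 ω))) ∂μ < ∞)
    (D ε η : ℝ) (hD : 0 ≤ D) (hε : 0 < ε) (hη : 0 < η) (k b₀ : ℕ)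
    (hH : ∀ b, b₀ ≤ b → condEntropy X μ b k ≤ ENNReal.ofReal (D * b)) :
    ∃ b₁ M₁ : ℕ, ∀ b M t : ℕ, b₁ ≤ b → M₁ ≤ M →
      μ {ω | M * ((D + ε) * b) < ∑ s ∈ Finset.range M, codeLength X μ b k
        (fun i => quantize b (shiftedBlock X (k + 1) ((t + s : ℕ) : ℤ) ω i))} ≤
      ENNReal.ofReal η := by
  set h : ℝ → ℝ := fun x => -Real.logb 2 (floorProb X μ x) with hh
  have hhm : Measurable h := (measurable_floorProb.log.div_const _).neg
  obtain ⟨T, hT⟩ := exists_lintegral_sub_le (μ := μ) (fun ω => h (X 1 ω)) (hhm.comp (hX 1)) hfin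
    (ENNReal.ofReal (η / 2)) (by simpa using hη)
  -- Chosen so that `κ e² ≤ (η / 4) (ε b / 4)²` whenever the mean satisfies `e ≤ (1 + D) b`.
  set κ : ℝ := η / 4 * (ε / 4) ^ 2 / (1 + D) ^ 2 with hκ
  have hκ0 : 0 < κ := by positivity
  obtain ⟨G, hG⟩ : ∃ G, ∀ g, G ≤ g → psiStar X μ g ≤ ENNReal.ofReal (1 + κ) := by
    have : (1 : ℝ≥0∞) < ENNReal.ofReal (1 + κ) := by
      rw [← ENNReal.ofReal_one]
      exact (ENNReal.ofReal_lt_ofReal_iff (by positivity)).2 (by linarith)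
    exact eventually_atTop.1 (hmix.eventually (ge_mem_nhds this))
  set G' := G + (k + 1) with hG'
  obtain ⟨b₁, hb₁⟩ := exists_nat_ge (4 / ε)
  obtain ⟨M₁, hM₁⟩ := exists_nat_ge ((2 * G' + 1) * (2 + T) ^ 2 / ((ε / 4) ^ 2 * (η / 4)))
  refine ⟨max (max b₀ b₁) 1, max M₁ 1, fun b M t hb hM => ?_⟩
  have hbb₀ : b₀ ≤ b := ((le_max_left _ _).trans (le_max_left _ _)).trans hb
  have hbb₁ : (b₁ : ℝ) ≤ b := by
    exact_mod_cast ((le_max_right _ _).trans (le_max_left _ _)).trans hb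
  have hb1 : (1 : ℝ) ≤ b := by exact_mod_cast (le_max_right _ _).trans hb
  have hMM₁ : (M₁ : ℝ) ≤ M := by exact_mod_cast (le_max_left _ _).trans hM
  have hM1 : 0 < M := (le_max_right _ _).trans hM
  have hMpos : (0 : ℝ) < M := by exact_mod_cast hM1
  have hεb : 4 ≤ ε * b := by
    have := hb₁.trans hbb₁
    rw [div_le_iff₀ hε] at this
    linarith
  set C : (Fin (k + 1) → ℝ) → ℝ := fun x => codeLength X μ b k fun i => quantize b (x i) with hC
  set B : ℝ := 1 + b + T with hB
  have hCm : Measurable C := measurable_comp_quantize b (k + 1) (codeLength X μ b k)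
  have hC0 : ∀ x, 0 ≤ C x := fun x => codeLength_nonneg _ _ _
  set F : (Fin (k + 1) → ℝ) → ℝ := fun x => min (C x) B with hF
  have hFm : Measurable F := hCm.min measurable_const
  have hB0 : 0 ≤ B := by positivity
  have hF0 : ∀ x, 0 ≤ F x := fun x => le_min (hC0 x) hB0
  have hFB : ∀ x, F x ≤ B := fun x => min_le_right _ _
  have hpos := ae_blockProb_pos (μ := μ) hX b (k + 1)
  set e : ℝ := ∫ ω, F (initialBlock X (k + 1) ω) ∂μ with he
  have he0 : 0 ≤ e := integral_nonneg fun ω => hF0 _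
  have heD : e ≤ 1 + D * b := by
    have h1 : ∫⁻ ω, ENNReal.ofReal (F (initialBlock X (k + 1) ω)) ∂μ ≤
        ENNReal.ofReal (1 + D * b) := by
      calc _ ≤ ∫⁻ ω, (1 + ENNReal.ofReal (condInfo X μ b k
              fun i => quantize b (initialBlock X (k + 1) ω i))) ∂μ := by
            refine lintegral_mono_ae ?_
            filter_upwards [hpos] with ω hω
            rw [← ENNReal.ofReal_one, ← ENNReal.ofReal_add zero_le_one (condInfo_nonneg _ _ _)]
            exact ENNReal.ofReal_le_ofReal ((min_le_left _ _).trans (codeLength_le_condInfo b k _ hω))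
        _ ≤ 1 + ENNReal.ofReal (D * b) := by
            rw [lintegral_add_left measurable_const, lintegral_const, measure_univ, mul_one]
            gcongr
            exact (lintegral_condInfo_le hX b k).trans (hH b hbb₀)
        _ = _ := by
            rw [ENNReal.ofReal_add zero_le_one (by positivity), ENNReal.ofReal_one]
    rw [he, integral_eq_lintegral_of_nonneg_ae (ae_of_all _ fun ω => hF0 _)
      (hFm.comp (measurable_initialBlock hX _)).aestronglyMeasurable]
    have := ENNReal.toReal_mono ENNReal.ofReal_ne_top h1
    rwa [ENNReal.toReal_ofReal (by positivity)] at this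
  set W : ℕ → Ω → ℝ := fun s ω => F (shiftedBlock X (k + 1) ((t + s : ℕ) : ℤ) ω) with hW
  have hWm : ∀ s, Measurable (W s) := fun s => hFm.comp (measurable_shiftedBlock hX _ _)
  have hWe : ∀ s, ∫ ω, W s ω ∂μ = e := by
    intro s
    rw [he, integral_eq_lintegral_of_nonneg_ae (ae_of_all _ fun ω => hF0 _)
      (hWm s).aestronglyMeasurable, integral_eq_lintegral_of_nonneg_ae
      (ae_of_all _ fun ω => hF0 _) (hFm.comp (measurable_initialBlock hX _)).aestronglyMeasurable]
    congr 1
    exact lintegral_shiftedBlock hX hstat (k + 1) _ (fun x => ENNReal.ofReal (F x))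
      hFm.ennreal_ofReal
  have hcorr : ∀ s s', s + G' ≤ s' → ∫ ω, W s ω * W s' ω ∂μ ≤ (1 + κ) * e ^ 2 := fun s s' hs =>
    integral_mul_shiftedBlock_le hX hstat (k + 1) G κ hκ0.le hG F hFm hF0 B hFB _ _ (by omega)
  have hcheb := measureReal_sum_ge_le (μ := μ) M G' hM1 W B e κ (ε / 4 * b) (by positivity) hκ0.le
    hWm (fun s ω => hF0 _) (fun s ω => hFB _) hWe hcorr
  have hcheb' : μ {ω | M * (e + ε / 4 * b) ≤ ∑ s ∈ Finset.range M, W s ω} ≤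
      ENNReal.ofReal (η / 2) := by
    rw [← ofReal_measureReal]
    apply ENNReal.ofReal_le_ofReal
    refine hcheb.trans ?_
    rw [div_le_iff₀ (by positivity)]
    have h1 : (2 * (G' : ℝ) + 1) * B ^ 2 / M ≤ η / 4 * (ε / 4 * b) ^ 2 := by
      have hBb : B ≤ (2 + T) * b := by
        have : (T : ℝ) ≤ T * b := le_mul_of_one_le_right (Nat.cast_nonneg _) hb1
        rw [hB]; linarith
      have h2 := hM₁.trans hMM₁
      rw [div_le_iff₀ (by positivity)] at h2
      rw [div_le_iff₀ hMpos]
      calc (2 * (G' : ℝ) + 1) * B ^ 2 ≤ (2 * (G' : ℝ) + 1) * ((2 + T) * b) ^ 2 := by gcongr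
        _ = ((2 * (G' : ℝ) + 1) * (2 + T) ^ 2) * b ^ 2 := by ring
        _ ≤ (M * ((ε / 4) ^ 2 * (η / 4))) * b ^ 2 := by gcongr
        _ = _ := by ring
    have h2 : κ * e ^ 2 ≤ η / 4 * (ε / 4 * b) ^ 2 := by
      have heb : e ≤ (1 + D) * b := by linarith
      calc κ * e ^ 2 ≤ κ * ((1 + D) * b) ^ 2 := by gcongr
        _ = _ := by rw [hκ]; field_simp
    linarith
  set R : ℕ → Ω → ℝ≥0∞ := fun s ω =>
    ENNReal.ofReal (h (X (((t + s + k + 1 : ℕ) : ℤ)) ω) - T) with hR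
  have hRm : ∀ s, Measurable (R s) := fun s => ((hhm.comp (hX _)).sub_const _).ennreal_ofReal
  have hmarkov : μ {ω | (M : ℝ≥0∞) ≤ ∑ s ∈ Finset.range M, R s ω} ≤ ENNReal.ofReal (η / 2) := by
    have h1 := mul_meas_ge_le_lintegral₀ (μ := μ)
      (Finset.measurable_fun_sum (Finset.range M) fun s _ => hRm s).aemeasurable (M : ℝ≥0∞)
    rw [lintegral_finsetSum _ fun s _ => hRm s] at h1
    have h2 : ∀ s, ∫⁻ ω, R s ω ∂μ ≤ ENNReal.ofReal (η / 2) := fun s =>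
      (lintegral_eq_of_isStationary hX hstat (fun x => ENNReal.ofReal (h x - T))
        (hhm.sub_const _).ennreal_ofReal _).trans_le hT
    have h3 := h1.trans (Finset.sum_le_sum fun s _ => h2 s)
    rw [Finset.sum_const, Finset.card_range, nsmul_eq_mul] at h3
    exact (ENNReal.mul_le_mul_iff_right (by exact_mod_cast hM1.ne') (ENNReal.natCast_ne_top M)).1 h3
  have hposs : ∀ᵐ ω ∂μ, ∀ s : ℕ, 0 < blockProb X μ b (k + 1)
      (fun i => quantize b (shiftedBlock X (k + 1) ((t + s : ℕ) : ℤ) ω i)) := by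
    refine ae_all_iff.2 fun s => ?_
    refine ae_shiftedBlock hX hstat (k + 1) _
      (fun x => 0 < blockProb X μ b (k + 1) fun i => quantize b (x i)) ?_ hpos
    exact measurableSet_lt measurable_const (measurable_comp_quantize b (k + 1) _)
  have hincl : ∀ᵐ ω ∂μ, (M * ((D + ε) * b) < ∑ s ∈ Finset.range M, codeLength X μ b k
        (fun i => quantize b (shiftedBlock X (k + 1) ((t + s : ℕ) : ℤ) ω i))) →
      ω ∈ {ω | M * (e + ε / 4 * b) ≤ ∑ s ∈ Finset.range M, W s ω} ∪
        {ω | (M : ℝ≥0∞) ≤ ∑ s ∈ Finset.range M, R s ω} := by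
    filter_upwards [hposs] with ω hω hlt
    by_contra hc
    simp only [Set.mem_union, Set.mem_ofPred_eq, not_or, not_le] at hc
    have h1 : ∀ s, codeLength X μ b k
        (fun i => quantize b (shiftedBlock X (k + 1) ((t + s : ℕ) : ℤ) ω i)) ≤
        W s ω + (R s ω).toReal := by
      intro s
      have h2 := codeLength_le_floorProb hX hstat b k _ (hω s)
      rw [floorProb_quantize] at h2
      have h3 : shiftedBlock X (k + 1) ((t + s : ℕ) : ℤ) ω (Fin.last k) =
          X (((t + s + k + 1 : ℕ) : ℤ)) ω := by
        simp only [shiftedBlock, Fin.val_last]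
        congr 1
        push_cast; ring
      rw [h3] at h2
      have h4 : h (X (((t + s + k + 1 : ℕ) : ℤ)) ω) - T ≤ (R s ω).toReal := by
        rw [hR, ENNReal.toReal_ofReal']
        exact le_max_left _ _
      have h5 : 0 ≤ (R s ω).toReal := ENNReal.toReal_nonneg
      rcases le_total (C (shiftedBlock X (k + 1) ((t + s : ℕ) : ℤ) ω)) B with h6 | h6
      · have : W s ω = C (shiftedBlock X (k + 1) ((t + s : ℕ) : ℤ) ω) := min_eq_left h6
        rw [this]
        exact le_add_of_nonneg_right h5
      · have : W s ω = B := min_eq_right h6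
        rw [this, hB]
        simp only [hh] at h4
        linarith
    have h2 : ∑ s ∈ Finset.range M, (R s ω).toReal ≤ M := by
      rw [← ENNReal.toReal_sum fun s _ => ENNReal.ofReal_ne_top]
      have := ENNReal.toReal_mono (ENNReal.natCast_ne_top M) hc.2.le
      rwa [ENNReal.toReal_natCast] at this
    have h3 := Finset.sum_le_sum fun s (_ : s ∈ Finset.range M) => h1 s
    rw [Finset.sum_add_distrib] at h3
    have h4 : M * ((D + ε) * b) < M * (e + ε / 4 * b) + M := by linarith [hc.1]
    have h5 : (M : ℝ) * (e + ε / 4 * b) + M = M * (e + ε / 4 * b + 1) := by ring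
    rw [h5] at h4
    -- With `e ≤ 1 + D b` and `4 ≤ ε b` the right side is at most `D b + ε b / 4 + 2 ≤ (D + 3 ε / 4)
    -- b`, a contradiction.
    have h6 := lt_of_mul_lt_mul_left h4 hMpos.le
    nlinarith
  calc _ ≤ μ ({ω | M * (e + ε / 4 * b) ≤ ∑ s ∈ Finset.range M, W s ω} ∪
        {ω | (M : ℝ≥0∞) ≤ ∑ s ∈ Finset.range M, R s ω}) := measure_mono_ae hincl
    _ ≤ ENNReal.ofReal (η / 2) + ENNReal.ofReal (η / 2) :=
        (measure_union_le _ _).trans (add_le_add hcheb' hmarkov)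
    _ = ENNReal.ofReal η := by
        rw [← ENNReal.ofReal_add (by positivity) (by positivity), add_halves]

/-- A model of order `k₀` serves as a conditional model of order `k ≥ k₀` that reads only the last
`k₀` letters of the context. So `k` may grow with `n` while the weak law is needed for the fixed
order `k₀` only. -/
theorem linearCost_self_le_codeLength [IsProbabilityMeasure μ] (hX : ∀ i, Measurable (X i))
    (U : Set ℝ) (k₀ k b n : ℕ) (hk : k₀ ≤ k) (hkn : k + 1 < n) (ω : Ω)
    (hU : ∀ i, quantize b (X i ω) ∈ U)
    (hpos : ∀ s : ℕ, 0 < blockProb X μ b (k₀ + 1)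
      (fun i => quantize b (shiftedBlock X (k₀ + 1) ((k - k₀ + s : ℕ) : ℤ) ω i))) :
    linearCost k U (empWeight k (fun i => quantize b (initialBlock X n ω i)))
      (fun i => quantize b (initialBlock X n ω i)) ≤ ENNReal.ofReal
      ((∑ s ∈ Finset.range (n - (k + 1)), codeLength X μ b k₀
        (fun i => quantize b (shiftedBlock X (k₀ + 1) ((k - k₀ + s : ℕ) : ℤ) ω i))) /
        ((n - (k + 1) : ℕ) : ℝ)) := by
  generalize hq : (fun i => quantize b (initialBlock X n ω i)) = q
  have hqi : ∀ i, q i = quantize b (X (i + 1) ω) := fun i => by rw [← hq]; rfl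
  let Q : (Fin k → ℝ) → ℝ → ℝ := fun y c => modelProb X μ b k₀
    (Fin.snoc (α := fun _ => ℝ) (fun j : Fin k₀ => y ⟨k - k₀ + j, by omega⟩) c)
  have hwin : ∀ s, Q (Fin.init (window k q s)) (window k q s (Fin.last k)) =
      modelProb X μ b k₀
      (fun i => quantize b (shiftedBlock X (k₀ + 1) ((k - k₀ + s.1 : ℕ) : ℤ) ω i)) := by
    intro s
    refine congrArg (modelProb X μ b k₀) (funext fun i => ?_)
    refine Fin.lastCases ?_ (fun j => ?_) i
    · simp only [Fin.snoc_last, window, hqi, shiftedBlock, Fin.val_last]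
      congr 2
      omega
    · simp only [Fin.snoc_castSucc, Fin.init, window, hqi, shiftedBlock, Fin.val_castSucc]
      congr 2
      push_cast
      omega
  have h := linearCost_self_le k hkn U q (fun i => by rw [hqi]; exact hU _) Q
    (fun y c => modelProb_nonneg _ _ _)
    (fun y => sum_modelProb_le_one hX b k₀ _ _ fun c hc => by
      obtain ⟨i, -, rfl⟩ := Finset.mem_image.1 hc
      rw [hqi]
      exact ⟨_, gridPoint_floor b _⟩)
    (fun s => by rw [hwin]; exact modelProb_pos b k₀ _ (hpos _))
  simp only [hwin] at h
  rw [Finset.sum_range]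
  exact h

/-- The empirical conditional entropy of the quantized source exceeds its information dimension
times the number of bits by a small factor only, with high probability. -/
theorem linearCost_self_concentration [IsProbabilityMeasure μ] (hX : ∀ i, Measurable (X i))
    (𝒳 : Set ℝ) (hX𝒳 : ∀ i, ∀ᵐ ω ∂μ, X i ω ∈ 𝒳)
    (hstat : IsStationary X μ) (hmix : IsPsiStarMixing X μ) (d : ℝ≥0∞) (hd : IsUpperInfoDim X μ d)
    (hdtop : d ≠ ∞) (ε η : ℝ) (hε : 0 < ε) (hη : 0 < η) :
    ∃ k₀ b₁ M₁ : ℕ, ∀ k b n : ℕ, k₀ ≤ k → b₁ ≤ b → k + 1 + M₁ ≤ n → k + 1 < n →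
      μ {ω | ¬ linearCost k (quantizedAlphabet 𝒳 b)
          (empWeight k (fun i => quantize b (initialBlock X n ω i)))
          (fun i => quantize b (initialBlock X n ω i)) ≤ ENNReal.ofReal ((d.toReal + ε) * b)} ≤
        ENNReal.ofReal η := by
  have hlt : d < ENNReal.ofReal (d.toReal + ε / 2) := by
    rw [← ENNReal.ofReal_toReal hdtop, ENNReal.toReal_ofReal ENNReal.toReal_nonneg]
    exact (ENNReal.ofReal_lt_ofReal_iff (by positivity)).2 (by linarith)
  obtain ⟨k₀, hk₀⟩ := eventually_atTop.1 (hd.eventually (gt_mem_nhds hlt))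
  have hent : ∀ k, k₀ ≤ k → ∀ᶠ b : ℕ in atTop,
      condEntropy X μ b k ≤ ENNReal.ofReal ((d.toReal + ε / 2) * b) := by
    intro k hk
    filter_upwards [eventually_lt_of_limsup_lt (hk₀ k hk), eventually_gt_atTop 0] with b hb hb0
    rw [ENNReal.ofReal_mul (by positivity), ENNReal.ofReal_natCast]
    exact (ENNReal.div_le_iff (by exact_mod_cast hb0.ne') (ENNReal.natCast_ne_top b)).1 hb.le
  have hfin : ∫⁻ ω, ENNReal.ofReal (-Real.logb 2 (floorProb X μ (X 1 ω))) ∂μ < ∞ := by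
    obtain ⟨g, hg⟩ := ((hmix.eventually (ge_mem_nhds ENNReal.one_lt_two)).and
      (eventually_gt_atTop 0)).exists
    have hall : ∀ᶠ b : ℕ in atTop, ∀ j ∈ Finset.range g,
        condEntropy X μ b (k₀ + j) ≤ ENNReal.ofReal ((d.toReal + ε / 2) * b) :=
      (Finset.eventually_all _).2 fun j _ => hent (k₀ + j) (by omega)
    obtain ⟨b, hb⟩ := hall.exists
    exact lintegral_floorProb_lt_top hX hstat b k₀ g hg.2 hg.1 fun j hj =>
      ((hb j (Finset.mem_range.2 hj)).trans_lt ENNReal.ofReal_lt_top).ne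
  obtain ⟨b₀, hb₀⟩ := eventually_atTop.1 (hent k₀ le_rfl)
  obtain ⟨b₁, M₁, hconc⟩ := codeLength_concentration hX hstat hmix hfin (d.toReal + ε / 2) (ε / 2) η
    (by positivity) (by positivity) hη k₀ b₀ hb₀
  refine ⟨k₀, b₁, M₁, fun k b n hk hb hn hkn => ?_⟩
  refine le_trans (measure_mono_ae ?_) (hconc b (n - (k + 1)) (k - k₀) hb (by omega))
  have hposs : ∀ᵐ ω ∂μ, ∀ s : ℕ, 0 < blockProb X μ b (k₀ + 1)
      (fun i => quantize b (shiftedBlock X (k₀ + 1) ((k - k₀ + s : ℕ) : ℤ) ω i)) := by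
    refine ae_all_iff.2 fun s => ?_
    refine ae_shiftedBlock hX hstat (k₀ + 1) _
      (fun x => 0 < blockProb X μ b (k₀ + 1) fun i => quantize b (x i)) ?_
      (ae_blockProb_pos hX b (k₀ + 1))
    exact measurableSet_lt measurable_const (measurable_comp_quantize b (k₀ + 1) _)
  filter_upwards [hposs, ae_all_iff.2 hX𝒳] with ω hω hω𝒳 hnot
  by_contra hle
  refine hnot ((linearCost_self_le_codeLength hX _ k₀ k b n hk hkn ω
    (fun i => Set.mem_image_of_mem _ (hω𝒳 _)) hω).trans (ENNReal.ofReal_le_ofReal ?_))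
  have hM : (0 : ℝ) < ((n - (k + 1) : ℕ) : ℝ) := by
    have : 0 < n - (k + 1) := by omega
    exact_mod_cast this
  rw [div_le_iff₀ hM]
  refine (not_lt.1 hle).trans (le_of_eq ?_)
  ring

end

section

/-! ### Gaussian measurement matrices -/

theorem integral_exp_neg_mul_sq_gaussianReal (s : ℝ) (v : NNReal) (hs : 0 < s) (hv : v ≠ 0) :
    ∫ x, Real.exp (-s * x ^ 2) ∂(gaussianReal 0 v) = (√(2 * s * v + 1))⁻¹ := by
  have hv' : (0 : ℝ) < v := NNReal.coe_pos.2 (pos_iff_ne_zero.2 hv)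
  have hpi := Real.pi_pos
  rw [integral_gaussianReal_eq_integral_smul hv]
  have e : ∀ x : ℝ, gaussianPDFReal 0 v x • Real.exp (-s * x ^ 2) =
      (√(2 * Real.pi * v))⁻¹ * Real.exp (-(s + 1 / (2 * v)) * x ^ 2) := by
    intro x
    rw [gaussianPDFReal, smul_eq_mul, mul_assoc, ← Real.exp_add]
    congr 2
    field_simp
    ring
  simp only [e]
  rw [integral_const_mul, integral_gaussian, ← Real.sqrt_inv, ← Real.sqrt_mul (by positivity),
    ← Real.sqrt_inv]
  congr 1
  field_simp

variable {Ω : Type*} [MeasurableSpace Ω] {μ : Measure Ω} {m n : ℕ} {A : Ω → Matrix (Fin m) (Fin n) ℝ}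

theorem memLp_entry (hAlaw : ∀ i j, HasLaw (fun ω => A ω i j) (gaussianReal 0 1) μ) (i : Fin m)
    (j : Fin n) : MemLp (fun ω => A ω i j) 2 μ :=
  (hAlaw i j).hasGaussianLaw.memLp_two

theorem integral_entry (hAlaw : ∀ i j, HasLaw (fun ω => A ω i j) (gaussianReal 0 1) μ)
    (i : Fin m) (j : Fin n) : ∫ ω, A ω i j ∂μ = 0 := by
  rw [(hAlaw i j).integral_eq, integral_id_gaussianReal]

theorem covariance_entry [IsProbabilityMeasure μ]
    (hAlaw : ∀ i j, HasLaw (fun ω => A ω i j) (gaussianReal 0 1) μ)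
    (hAindep : iIndepFun (fun (p : Fin m × Fin n) ω => A ω p.1 p.2) μ)
    (i i' : Fin m) (j j' : Fin n) :
    cov[fun ω => A ω i j, fun ω => A ω i' j'; μ] = if (i, j) = (i', j') then 1 else 0 := by
  split_ifs with h
  · obtain ⟨rfl, rfl⟩ := Prod.mk.inj h
    rw [covariance_self (hAlaw i j).aemeasurable, (hAlaw i j).variance_eq, variance_id_gaussianReal]
    simp
  · exact (hAindep.indepFun h).covariance_eq_zero (memLp_entry hAlaw i j)
      (memLp_entry hAlaw i' j')

theorem covariance_mulVec [IsProbabilityMeasure μ]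
    (hAlaw : ∀ i j, HasLaw (fun ω => A ω i j) (gaussianReal 0 1) μ)
    (hAindep : iIndepFun (fun (p : Fin m × Fin n) ω => A ω p.1 p.2) μ) (v : Fin n → ℝ)
    (i i' : Fin m) :
    cov[fun ω => (A ω).mulVec v i, fun ω => (A ω).mulVec v i'; μ] =
      if i = i' then ∑ j, v j ^ 2 else 0 := by
  simp only [Matrix.mulVec, dotProduct]
  rw [covariance_fun_sum_fun_sum (fun j => (memLp_entry hAlaw i j).mul_const _)
    (fun j => (memLp_entry hAlaw i' j).mul_const _)]
  simp only [covariance_mul_const_left, covariance_mul_const_right,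
    covariance_entry hAlaw hAindep, Prod.mk.injEq]
  by_cases h : i = i'
  · simp [h, sq]
  · simp [h]

theorem hasGaussianLaw_mulVec (hAlaw : ∀ i j, HasLaw (fun ω => A ω i j) (gaussianReal 0 1) μ)
    (hAindep : iIndepFun (fun (p : Fin m × Fin n) ω => A ω p.1 p.2) μ) (v : Fin n → ℝ) :
    HasGaussianLaw (fun ω i => (A ω).mulVec v i) μ := by
  have h1 : HasGaussianLaw (fun ω (p : Fin m × Fin n) => A ω p.1 p.2) μ :=
    hAindep.hasGaussianLaw fun p => (hAlaw p.1 p.2).hasGaussianLaw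
  exact h1.map_fun (ContinuousLinearMap.pi fun i : Fin m =>
    ∑ j : Fin n, (ContinuousLinearMap.proj (R := ℝ) (i, j)).smulRight (v j)) |>.congr
      (ae_of_all _ fun ω => by
        funext i
        simp [Matrix.mulVec, dotProduct])

/-- The coordinates are jointly Gaussian and uncorrelated. -/
theorem iIndepFun_mulVec [IsProbabilityMeasure μ]
    (hAlaw : ∀ i j, HasLaw (fun ω => A ω i j) (gaussianReal 0 1) μ)
    (hAindep : iIndepFun (fun (p : Fin m × Fin n) ω => A ω p.1 p.2) μ) (v : Fin n → ℝ) :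
    iIndepFun (fun i ω => (A ω).mulVec v i) μ :=
  (hasGaussianLaw_mulVec hAlaw hAindep v).iIndepFun_of_covariance_eq_zero fun i i' h => by
    rw [covariance_mulVec hAlaw hAindep, if_neg h]

theorem map_mulVec [IsProbabilityMeasure μ]
    (hAlaw : ∀ i j, HasLaw (fun ω => A ω i j) (gaussianReal 0 1) μ)
    (hAindep : iIndepFun (fun (p : Fin m × Fin n) ω => A ω p.1 p.2) μ) (v : Fin n → ℝ)
    (i : Fin m) :
    μ.map (fun ω => (A ω).mulVec v i) = gaussianReal 0 (∑ j, v j ^ 2).toNNReal := by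
  have h := (hasGaussianLaw_mulVec hAlaw hAindep v).eval i
  rw [h.map_eq_gaussianReal, ← covariance_self h.aemeasurable, covariance_mulVec hAlaw hAindep,
    if_pos rfl]
  congr 1
  simp only [Matrix.mulVec, dotProduct]
  rw [integral_finsetSum _ fun j _ => ((memLp_entry hAlaw i j).integrable one_le_two).mul_const _]
  simp [integral_mul_const, integral_entry hAlaw]

/-- The small ball probability of `A v` for a Gaussian matrix `A`. -/
theorem measureReal_mulVec_le [IsProbabilityMeasure μ]
    (hAlaw : ∀ i j, HasLaw (fun ω => A ω i j) (gaussianReal 0 1) μ)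
    (hAindep : iIndepFun (fun (p : Fin m × Fin n) ω => A ω p.1 p.2) μ) (v : Fin n → ℝ)
    (hm : 0 < m) (τ : ℝ) (hτ : 0 < τ) (hv : 0 < ∑ j, v j ^ 2) :
    μ.real {ω | ∑ i, (A ω).mulVec v i ^ 2 ≤ τ} ≤
      (Real.exp 1 * τ / (m * ∑ j, v j ^ 2)) ^ ((m : ℝ) / 2) := by
  have hm' : (0 : ℝ) < m := by exact_mod_cast hm
  set σ : ℝ := ∑ j, v j ^ 2 with hσ
  -- The Chernoff parameter that minimizes `exp (s τ) (2 s σ) ^ (-m / 2)`, the bound obtained after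
  -- dropping the 1 in `2 s σ + 1`.
  set s : ℝ := m / (2 * τ) with hs
  have hs0 : 0 < s := by positivity
  set R : Fin m → Ω → ℝ := fun i ω => (A ω).mulVec v i ^ 2 with hR
  have hae : ∀ i, AEMeasurable (fun ω => (A ω).mulVec v i) μ := fun i =>
    ((hasGaussianLaw_mulVec hAlaw hAindep v).eval i).aemeasurable
  have hRae : ∀ i, AEMeasurable (R i) μ := fun i => (hae i).pow_const 2
  have hRind : iIndepFun R μ := (iIndepFun_mulVec hAlaw hAindep v).comp (fun _ x => x ^ 2)
    fun _ => measurable_id.pow_const 2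
  have hmgf : ∀ i, mgf (R i) μ (-s) ≤ √(τ / (m * σ)) := by
    intro i
    have h1 : mgf (R i) μ (-s) = ∫ x, Real.exp (-s * x ^ 2) ∂(gaussianReal 0 σ.toNNReal) := by
      rw [← map_mulVec hAlaw hAindep v i, integral_map (hae i)
        (by fun_prop : Measurable fun x : ℝ => Real.exp (-s * x ^ 2)).aestronglyMeasurable]
      rfl
    rw [h1, integral_exp_neg_mul_sq_gaussianReal s _ hs0 (by simpa using hv),
      Real.coe_toNNReal _ hv.le, ← Real.sqrt_inv]
    apply Real.sqrt_le_sqrt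
    have h2 : m * σ / τ ≤ 2 * s * σ + 1 := by
      have : 2 * s * σ = m * σ / τ := by rw [hs]; field_simp
      linarith
    calc (2 * s * σ + 1)⁻¹ ≤ (m * σ / τ)⁻¹ := by gcongr
      _ = τ / (m * σ) := inv_div _ _
  have hint : Integrable (fun ω => Real.exp (-s * (∑ i, R i) ω)) μ := by
    refine Integrable.of_bound (C := 1) ?_ (ae_of_all _ fun ω => ?_)
    · exact ((Finset.aemeasurable_sum _ fun i _ => hRae i).const_mul
        (-s)).exp.aestronglyMeasurable
    · rw [Real.norm_of_nonneg (Real.exp_nonneg _), Real.exp_le_one_iff, Finset.sum_apply]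
      have : 0 ≤ ∑ i, R i ω := Finset.sum_nonneg fun i _ => sq_nonneg _
      nlinarith
  have hch := measure_le_le_exp_mul_mgf τ (neg_nonpos.2 hs0.le) hint
  simp only [Finset.sum_apply] at hch
  refine hch.trans ?_
  rw [hRind.mgf_sum₀ hRae]
  calc Real.exp (- -s * τ) * ∏ i, mgf (R i) μ (-s)
      ≤ Real.exp (- -s * τ) * ∏ _i : Fin m, √(τ / (m * σ)) := by
        gcongr with i _
        · exact fun _ _ => mgf_nonneg
        · exact hmgf i
    _ = (Real.exp 1 * τ / (m * σ)) ^ ((m : ℝ) / 2) := by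
        rw [Finset.prod_const, Finset.card_univ, Fintype.card_fin, mul_div_assoc,
          Real.mul_rpow (Real.exp_nonneg _) (by positivity), ← Real.exp_mul, one_mul,
          Real.sqrt_eq_rpow, ← Real.rpow_natCast, ← Real.rpow_mul (by positivity)]
        congr 2
        · rw [hs]; field_simp
        · ring

/-- The mean square of `A e` for a Gaussian matrix `A` and an independent bounded vector `e`. -/
theorem lintegral_mulVec_sq_le [IsProbabilityMeasure μ]
    (hAlaw : ∀ i j, HasLaw (fun ω => A ω i j) (gaussianReal 0 1) μ)
    (hAindep : iIndepFun (fun (p : Fin m × Fin n) ω => A ω p.1 p.2) μ) (e : Ω → Fin n → ℝ)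
    (he : Measurable e) (hAe : IndepFun (fun ω (p : Fin m × Fin n) => A ω p.1 p.2) e μ)
    (c : ℝ) (hc : ∀ ω j, |e ω j| ≤ c) :
    ∫⁻ ω, ENNReal.ofReal (∑ i, (A ω).mulVec (e ω) i ^ 2) ∂μ ≤ ENNReal.ofReal (m * (n * c ^ 2)) := by
  have hej : ∀ j, Measurable fun ω => e ω j := fun j => (measurable_pi_apply j).comp he
  have hAint : ∀ i j j', Integrable (fun ω => A ω i j * A ω i j') μ := fun i j j' =>
    (memLp_entry hAlaw i j).integrable_mul (memLp_entry hAlaw i j')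
  have hAmean : ∀ i j j', ∫ ω, A ω i j * A ω i j' ∂μ = if j = j' then 1 else 0 := by
    intro i j j'
    have h1 := covariance_eq_sub (memLp_entry hAlaw i j) (memLp_entry hAlaw i j')
    rw [covariance_entry hAlaw hAindep, integral_entry hAlaw, zero_mul, sub_zero] at h1
    simpa using h1.symm
  have hebd : ∀ ω j j', ‖e ω j * e ω j'‖ ≤ c ^ 2 := by
    intro ω j j'
    rw [norm_mul, sq]
    exact mul_le_mul (hc ω j) (hc ω j') (norm_nonneg _) ((abs_nonneg _).trans (hc ω j))
  have heint : ∀ j j', Integrable (fun ω => e ω j * e ω j') μ := fun j j' =>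
    Integrable.of_bound ((hej j).mul (hej j')).aestronglyMeasurable (c ^ 2)
      (ae_of_all _ fun ω => hebd ω j j')
  have hind : ∀ i j j', IndepFun (fun ω => A ω i j * A ω i j') (fun ω => e ω j * e ω j') μ := by
    intro i j j'
    exact hAe.comp (φ := fun a : Fin m × Fin n → ℝ => a (i, j) * a (i, j'))
      (ψ := fun x : Fin n → ℝ => x j * x j') (by fun_prop) (by fun_prop)
  have hexp : ∀ ω, ∑ i, (A ω).mulVec (e ω) i ^ 2 =
      ∑ i, ∑ j, ∑ j', (A ω i j * A ω i j') * (e ω j * e ω j') := by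
    intro ω
    refine Finset.sum_congr rfl fun i _ => ?_
    rw [sq, Matrix.mulVec, dotProduct, Finset.sum_mul_sum]
    refine Finset.sum_congr rfl fun j _ => Finset.sum_congr rfl fun j' _ => ?_
    ring
  have hint : ∀ i j j', Integrable
      (fun ω => (A ω i j * A ω i j') * (e ω j * e ω j')) μ := fun i j j' =>
    (hind i j j').integrable_mul (hAint i j j') (heint j j')
  simp only [hexp]
  rw [← ofReal_integral_eq_lintegral_ofReal]
  · apply ENNReal.ofReal_le_ofReal
    rw [integral_finsetSum _ fun i _ => integrable_finsetSum _ fun j _ =>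
      integrable_finsetSum _ fun j' _ => hint i j j']
    have hrow : ∀ i : Fin m, ∫ ω, ∑ j, ∑ j', (A ω i j * A ω i j') * (e ω j * e ω j') ∂μ ≤
        n * c ^ 2 := by
      intro i
      rw [integral_finsetSum _ fun j _ => integrable_finsetSum _ fun j' _ => hint i j j']
      have : ∀ j, ∫ ω, ∑ j', (A ω i j * A ω i j') * (e ω j * e ω j') ∂μ ≤ c ^ 2 := by
        intro j
        rw [integral_finsetSum _ fun j' _ => hint i j j']
        have h1 : ∀ j', ∫ ω, (A ω i j * A ω i j') * (e ω j * e ω j') ∂μ =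
            (if j = j' then 1 else 0) * ∫ ω, e ω j * e ω j' ∂μ := by
          intro j'
          rw [← hAmean i j j']
          exact (hind i j j').integral_fun_mul_eq_mul_integral
            (hAint i j j').aestronglyMeasurable (heint j j').aestronglyMeasurable
        simp only [h1, ite_mul, one_mul, zero_mul, Finset.sum_ite_eq, Finset.mem_univ, if_true]
        have h2 := integral_mono (heint j j) (integrable_const (c ^ 2))
          fun ω => (le_abs_self _).trans (hebd ω j j)
        simpa using h2
      refine (Finset.sum_le_sum fun j _ => this j).trans ?_
      simp
    refine (Finset.sum_le_sum fun i _ => hrow i).trans ?_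
    simp
  · exact integrable_finsetSum _ fun i _ => integrable_finsetSum _ fun j _ =>
      integrable_finsetSum _ fun j' _ => hint i j j'
  · refine ae_of_all _ fun ω => ?_
    refine le_of_le_of_eq ?_ (hexp ω)
    exact Finset.sum_nonneg fun i _ => sq_nonneg _

end

section

/-! ### The union bound over all sequences of small cost -/

/-- The constant `∑_{j ∈ ℤ} 1 / max (1, j²)`. -/
def latticeSum : ℝ≥0∞ := ∑' j : ℤ, ENNReal.ofReal (1 / max 1 ((j : ℝ) ^ 2))

theorem latticeSum_ne_top : latticeSum ≠ ∞ := by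
  have hs : Summable fun j : ℤ => 1 / (j : ℝ) ^ 2 + if j = 0 then 1 else 0 :=
    (Real.summable_one_div_int_pow.2 one_lt_two).add (summable_of_hasFiniteSupport
      ((Set.finite_singleton (0 : ℤ)).subset fun j hj => by
        by_contra h
        exact hj (if_neg h)))
  refine ne_top_of_le_ne_top hs.tsum_ofReal_ne_top (ENNReal.tsum_le_tsum fun j => ?_)
  apply ENNReal.ofReal_le_ofReal
  by_cases h : j = 0
  · simp [h]
  · rw [if_neg h, add_zero]
    have : (0 : ℝ) < (j : ℝ) ^ 2 := by
      have : (j : ℝ) ≠ 0 := by exact_mod_cast h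
      positivity
    exact one_div_le_one_div_of_le this (le_max_right _ _)

/-- After translating `z₀` to 0, each term is `s / max s (j² / 4^b)`, which is at most `s 4^b / max
1 j²` because `s 4^b ≥ 1`. This is the price of the unrestricted last letter. -/
theorem tsum_lattice_le (b : ℕ) (s : ℝ) (hs : 1 ≤ s * 4 ^ b) (z₀ : ℤ) :
    ∑' z : ℤ, ENNReal.ofReal (s / max s ((gridPoint b z - gridPoint b z₀) ^ 2)) ≤
      ENNReal.ofReal (s * 4 ^ b) * latticeSum := by
  have h4 : (0 : ℝ) < 4 ^ b := by positivity
  have hs0 : 0 < s := by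
    by_contra h
    have := mul_nonpos_of_nonpos_of_nonneg (not_lt.1 h) h4.le
    linarith
  rw [latticeSum, ← ENNReal.tsum_mul_left, ← (Equiv.addRight z₀).tsum_eq]
  refine ENNReal.tsum_le_tsum fun j => ?_
  rw [← ENNReal.ofReal_mul (by positivity)]
  apply ENNReal.ofReal_le_ofReal
  have e : (gridPoint b ((Equiv.addRight z₀) j) - gridPoint b z₀) ^ 2 = (j : ℝ) ^ 2 / 4 ^ b := by
    have : (4 : ℝ) ^ b = (2 ^ b) ^ 2 := by rw [← pow_mul, mul_comm, pow_mul]; norm_num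
    simp only [gridPoint, Equiv.coe_addRight]
    push_cast
    rw [this]
    field_simp
    ring
  rw [e, mul_one_div, div_le_div_iff₀ (by positivity) (by positivity), mul_assoc]
  refine mul_le_mul_of_nonneg_left (max_le ?_ ?_) hs0.le
  · calc (1 : ℝ) ≤ 4 ^ b * s := by linarith
      _ ≤ _ := by gcongr; exact le_max_left _ _
  · calc (j : ℝ) ^ 2 = 4 ^ b * ((j : ℝ) ^ 2 / 4 ^ b) := by field_simp
      _ ≤ _ := by gcongr; exact le_max_right _ _

variable {Ω : Type*} [MeasurableSpace Ω] {μ : Measure Ω}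

open Classical in
-- The squared distance is at least both `s` and the square `y` of the last difference, so the small
-- ball bound gains a factor `(s / max s y) ^ (m / 2)`. Since `m ≥ 2`, the exponent may be lowered
-- to 1. The result depends on the last letter alone and is still summable, so it can be the `g` of
-- `tsum_cost_le`.
theorem tsum_cost_prob_le [IsProbabilityMeasure μ] {m n k b : ℕ} (hkn : k + 1 < n)
    {A : Ω → Matrix (Fin m) (Fin n) ℝ}
    (hAlaw : ∀ i j, HasLaw (fun ω => A ω i j) (gaussianReal 0 1) μ)
    (hAindep : iIndepFun (fun (p : Fin m × Fin n) ω => A ω p.1 p.2) μ)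
    (hm : 2 ≤ m) (z : Fin n → ℤ) (B s τ : ℝ) (hB : 0 ≤ B)
    (hs : 1 ≤ s * 4 ^ b) (hs0 : 0 < s) (hτ : 0 < τ) :
    ∑' u : Fin n → ℤ,
      (if (∑ t, empWeight k (fun i => gridPoint b (z i))
            (window k (fun i => gridPoint b (u i)) t) ≤ ENNReal.ofReal B) ∧
          s ≤ ∑ i, (gridPoint b (u i) - gridPoint b (z i)) ^ 2
        then μ {ω | ∑ i, (A ω).mulVec (fun j => gridPoint b (u j) - gridPoint b (z j)) i ^ 2 ≤ τ}
        else 0) ≤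
      ENNReal.ofReal ((2 : ℝ) ^ B) * (n : ℝ≥0∞) ^ k *
        (ENNReal.ofReal ((Real.exp 1 * τ / (m * s)) ^ ((m : ℝ) / 2)) *
          (ENNReal.ofReal (s * 4 ^ b) * latticeSum)) := by
  obtain ⟨M, rfl⟩ : ∃ M, n = k + M + 1 := ⟨n - k - 1, by omega⟩
  have hM : 0 < M := by omega
  have hm' : (2 : ℝ) ≤ m := by exact_mod_cast hm
  set θ : ℝ := Real.exp 1 * τ / (m * s) with hθ
  have hθ0 : 0 < θ := by positivity
  set y : ℤ → ℝ := fun x => (gridPoint b x - gridPoint b (z (Fin.last _))) ^ 2 with hy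
  have hprob : ∀ u : Fin (k + M + 1) → ℤ,
      s ≤ ∑ i, (gridPoint b (u i) - gridPoint b (z i)) ^ 2 →
      μ {ω | ∑ i, (A ω).mulVec (fun j => gridPoint b (u j) - gridPoint b (z j)) i ^ 2 ≤ τ} ≤
        ENNReal.ofReal (θ ^ ((m : ℝ) / 2)) *
          ENNReal.ofReal (s / max s (y (u (Fin.last _)))) := by
    intro u hu
    rw [← ofReal_measureReal, ← ENNReal.ofReal_mul (by positivity)]
    apply ENNReal.ofReal_le_ofReal
    refine (measureReal_mulVec_le hAlaw hAindep _ (by omega) τ hτ (hs0.trans_le hu)).trans ?_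
    have hmax : max s (y (u (Fin.last _))) ≤
        ∑ i, (gridPoint b (u i) - gridPoint b (z i)) ^ 2 :=
      max_le hu (Finset.single_le_sum (f := fun i => (gridPoint b (u i) - gridPoint b (z i)) ^ 2)
        (fun _ _ => sq_nonneg _) (Finset.mem_univ (Fin.last _)))
    have hmax0 : 0 < max s (y (u (Fin.last _))) := hs0.trans_le (le_max_left _ _)
    have hratio : s / max s (y (u (Fin.last _))) ≤ 1 :=
      div_le_one_of_le₀ (le_max_left _ _) hmax0.le
    calc _ ≤ (Real.exp 1 * τ / (m * max s (y (u (Fin.last _))))) ^ ((m : ℝ) / 2) := by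
          gcongr
      _ = (θ * (s / max s (y (u (Fin.last _))))) ^ ((m : ℝ) / 2) := by
          congr 1
          rw [hθ]
          field_simp
      _ = θ ^ ((m : ℝ) / 2) * (s / max s (y (u (Fin.last _)))) ^ ((m : ℝ) / 2) :=
          Real.mul_rpow hθ0.le (by positivity)
      _ ≤ θ ^ ((m : ℝ) / 2) * (s / max s (y (u (Fin.last _)))) ^ (1 : ℝ) := by
          refine mul_le_mul_of_nonneg_left ?_ (by positivity)
          exact Real.rpow_le_rpow_of_exponent_ge (by positivity) hratio (by linarith)
      _ = _ := by rw [Real.rpow_one]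
  calc _ ≤ ∑' u : Fin (k + M + 1) → ℤ,
      (if ∑ t, empWeight k (fun i => gridPoint b (z i))
            (window k (fun i => gridPoint b (u i)) t) ≤ ENNReal.ofReal B
        then (fun x => ENNReal.ofReal (θ ^ ((m : ℝ) / 2)) *
          ENNReal.ofReal (s / max s (y x))) (u (Fin.last _)) else 0) := by
        refine ENNReal.tsum_le_tsum fun u => ?_
        by_cases h1 : ∑ t, empWeight k (fun i => gridPoint b (z i))
            (window k (fun i => gridPoint b (u i)) t) ≤ ENNReal.ofReal B
        · by_cases h2 : s ≤ ∑ i, (gridPoint b (u i) - gridPoint b (z i)) ^ 2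
          · rw [if_pos ⟨h1, h2⟩, if_pos h1]
            exact hprob u h2
          · rw [if_neg fun h => h2 h.2]
            exact zero_le
        · rw [if_neg fun h => h1 h.1]
          exact zero_le
    _ ≤ _ := tsum_cost_le (gridPoint b) (gridPoint_injective b) k M hM _ B hB
        (fun x => ENNReal.ofReal (θ ^ ((m : ℝ) / 2)) * ENNReal.ofReal (s / max s (y x)))
    _ ≤ _ := by
        rw [ENNReal.tsum_mul_left]
        gcongr
        exact tsum_lattice_le b s hs _

/-- With high probability no grid sequence that is far from the quantized signal has both small
cost and small measurement error. -/
theorem measure_exists_bad_le [IsProbabilityMeasure μ] {m n k b : ℕ} (hkn : k + 1 < n)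
    {A : Ω → Matrix (Fin m) (Fin n) ℝ} {x : Ω → Fin n → ℝ} (hx : Measurable x)
    (hAlaw : ∀ i j, HasLaw (fun ω => A ω i j) (gaussianReal 0 1) μ)
    (hAindep : iIndepFun (fun (p : Fin m × Fin n) ω => A ω p.1 p.2) μ)
    (hAx : IndepFun (fun ω (p : Fin m × Fin n) => A ω p.1 p.2) x μ)
    (hm : 2 ≤ m) (B s τ : ℝ) (hB : 0 ≤ B) (hs : 1 ≤ s * 4 ^ b) (hs0 : 0 < s) (hτ : 0 < τ) :
    μ {ω | ∃ v : Fin n → ℝ, (∀ i, v i ∈ Set.range (gridPoint b)) ∧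
        ∑ t, empWeight k (fun i => quantize b (x ω i)) (window k v t) ≤ ENNReal.ofReal B ∧
        s ≤ ∑ i, (v i - quantize b (x ω i)) ^ 2 ∧
        ∑ i, (A ω).mulVec (fun j => v j - quantize b (x ω j)) i ^ 2 ≤ τ} ≤
      ENNReal.ofReal ((2 : ℝ) ^ B) * (n : ℝ≥0∞) ^ k *
        (ENNReal.ofReal ((Real.exp 1 * τ / (m * s)) ^ ((m : ℝ) / 2)) *
          (ENNReal.ofReal (s * 4 ^ b) * latticeSum)) := by
  classical
  set Z : Ω → Fin n → ℤ := fun ω i => ⌊(2 : ℝ) ^ b * x ω i⌋ with hZ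
  have hZm : Measurable Z := (measurable_floor_block b n).comp hx
  have hq : ∀ ω i, quantize b (x ω i) = gridPoint b (Z ω i) := fun ω i => (gridPoint_floor b _).symm
  set P : (Fin n → ℤ) → (Fin n → ℤ) → Prop := fun z u =>
    (∑ t, empWeight k (fun i => gridPoint b (z i))
            (window k (fun i => gridPoint b (u i)) t) ≤ ENNReal.ofReal B) ∧
          s ≤ ∑ i, (gridPoint b (u i) - gridPoint b (z i)) ^ 2 with hP
  set S : (Fin n → ℤ) → (Fin n → ℤ) → Set Ω := fun z u =>
    {ω | ∑ i, (A ω).mulVec (fun j => gridPoint b (u j) - gridPoint b (z j)) i ^ 2 ≤ τ} with hS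
  set bound := ENNReal.ofReal ((2 : ℝ) ^ B) * (n : ℝ≥0∞) ^ k *
        (ENNReal.ofReal ((Real.exp 1 * τ / (m * s)) ^ ((m : ℝ) / 2)) *
          (ENNReal.ofReal (s * 4 ^ b) * latticeSum)) with hbound
  -- Once the quantized signal is fixed the weights are deterministic, and `A` keeps its law by
  -- independence. The union bound is therefore applied for each `z` and then averaged.
  have hinter : ∀ z u, μ ({ω | Z ω = z} ∩ S z u) = μ {ω | Z ω = z} * μ (S z u) := by
    intro z u
    have h := hAx.measure_inter_preimage_eq_mul
      {a | ∑ i, (∑ j, a (i, j) * (gridPoint b (u j) - gridPoint b (z j))) ^ 2 ≤ τ}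
      {y | (fun i => ⌊(2 : ℝ) ^ b * y i⌋) = z}
      (measurableSet_le (by fun_prop) measurable_const)
      ((measurable_floor_block b n) (measurableSet_singleton z))
    rw [Set.inter_comm, mul_comm]
    exact h
  have hsum : ∑' z, μ {ω | Z ω = z} = 1 := by
    have : ∫⁻ _, 1 ∂(μ.map Z) = 1 := by
      rw [lintegral_const, one_mul, Measure.map_apply hZm MeasurableSet.univ]
      simp
    rw [lintegral_countable'] at this
    simp only [one_mul] at this
    rw [← this]
    refine tsum_congr fun z => ?_
    rw [Measure.map_apply hZm (measurableSet_singleton z)]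
    rfl
  calc _ ≤ μ (⋃ (z : Fin n → ℤ), ⋃ (u : Fin n → ℤ), ⋃ (_ : P z u), {ω | Z ω = z} ∩ S z u) := by
        refine measure_mono fun ω hω => ?_
        obtain ⟨v, hv, h1, h2, h3⟩ := hω
        choose u hu using hv
        obtain rfl : (fun i => gridPoint b (u i)) = v := funext hu
        simp only [hq] at h1 h2 h3
        simp only [Set.mem_iUnion]
        exact ⟨Z ω, u, ⟨h1, h2⟩, rfl, h3⟩
    _ ≤ ∑' (z : Fin n → ℤ), ∑' (u : Fin n → ℤ),
          (if P z u then μ ({ω | Z ω = z} ∩ S z u) else 0) := by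
        refine (measure_iUnion_le _).trans (ENNReal.tsum_le_tsum fun z => ?_)
        refine (measure_iUnion_le _).trans (ENNReal.tsum_le_tsum fun u => ?_)
        split_ifs with h <;> simp [h]
    _ = ∑' (z : Fin n → ℤ), μ {ω | Z ω = z} * ∑' (u : Fin n → ℤ),
          (if P z u then μ (S z u) else 0) := by
        refine tsum_congr fun z => ?_
        rw [← ENNReal.tsum_mul_left]
        refine tsum_congr fun u => ?_
        rw [hinter, mul_ite, mul_zero]
    _ ≤ ∑' (z : Fin n → ℤ), μ {ω | Z ω = z} * bound := by
        refine ENNReal.tsum_le_tsum fun z => mul_le_mul_right ?_ _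
        exact tsum_cost_prob_le hkn hAlaw hAindep hm z B s τ hB hs hs0 hτ
    _ = bound := by rw [ENNReal.tsum_mul_right, hsum, one_mul]

/-! ### Properties of a minimizer -/

theorem toLp_norm_sq {n : ℕ} (v : Fin n → ℝ) : ‖WithLp.toLp 2 v‖ ^ 2 = ∑ i, v i ^ 2 := by
  rw [EuclideanSpace.real_norm_sq_eq]

/-- A minimizer has small cost and small measurement error. -/
theorem IsAMEPSolution.bounds {m n k : ℕ} {U : Set ℝ} {w : (Fin (k + 1) → ℝ) → ℝ≥0∞} {lam : ℝ}
    (hlam : 0 < lam) (hn : 0 < n) {A : Matrix (Fin m) (Fin n) ℝ} {x q v : Fin n → ℝ}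
    (hv : IsAMEPSolution k U w lam A (A.mulVec x) v) (hq : ∀ i, q i ∈ U) (h E : ℝ) (hh : 0 ≤ h)
    (hcost : linearCost k U w q ≤ ENNReal.ofReal h)
    (hE : ∑ i, A.mulVec (fun j => x j - q j) i ^ 2 ≤ E) :
    linearCost k U w v ≤ ENNReal.ofReal (h + lam / n ^ 2 * E) ∧
      ∑ i, A.mulVec (fun j => v j - q j) i ^ 2 ≤ 2 * (n ^ 2 * h / lam) + 4 * E := by
  have hn' : (0 : ℝ) < n := by exact_mod_cast hn
  have hE0 : 0 ≤ E := (Finset.sum_nonneg fun i _ => sq_nonneg _).trans hE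
  have hmin := hv.2 q hq
  have hqx : ‖WithLp.toLp 2 (A.mulVec q - A.mulVec x)‖ ^ 2 ≤ E := by
    rw [toLp_norm_sq]
    refine (le_of_eq (Finset.sum_congr rfl fun i _ => ?_)).trans hE
    have : (fun j => x j - q j) = x - q := rfl
    rw [this, Matrix.mulVec_sub, Pi.sub_apply, Pi.sub_apply]
    ring
  have hobj : amepObjective k U w lam A (A.mulVec x) v ≤ ENNReal.ofReal (h + lam / n ^ 2 * E) := by
    refine hmin.trans ?_
    rw [ENNReal.ofReal_add hh (by positivity)]
    refine add_le_add hcost (ENNReal.ofReal_le_ofReal ?_)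
    gcongr
  refine ⟨le_self_add.trans hobj, ?_⟩
  have h2 := (le_add_self.trans hobj : ENNReal.ofReal
    (lam / (n : ℝ) ^ 2 * ‖WithLp.toLp 2 (A.mulVec v - A.mulVec x)‖ ^ 2) ≤ _)
  rw [ENNReal.ofReal_le_ofReal_iff (by positivity), toLp_norm_sq] at h2
  have h3 : ∑ i, (A.mulVec v - A.mulVec x) i ^ 2 ≤ n ^ 2 * h / lam + E := by
    have : (n : ℝ) ^ 2 / lam * (lam / n ^ 2 * ∑ i, (A.mulVec v - A.mulVec x) i ^ 2) ≤
        (n : ℝ) ^ 2 / lam * (h + lam / n ^ 2 * E) := by gcongr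
    calc _ = (n : ℝ) ^ 2 / lam * (lam / n ^ 2 * ∑ i, (A.mulVec v - A.mulVec x) i ^ 2) := by
          field_simp
      _ ≤ _ := this
      _ = _ := by field_simp
  calc ∑ i, A.mulVec (fun j => v j - q j) i ^ 2
      ≤ ∑ i, (2 * (A.mulVec v - A.mulVec x) i ^ 2 + 2 * A.mulVec (fun j => x j - q j) i ^ 2) := by
        refine Finset.sum_le_sum fun i _ => ?_
        have e : A.mulVec (fun j => v j - q j) i =
            (A.mulVec v - A.mulVec x) i + A.mulVec (fun j => x j - q j) i := by
          have h1 : (fun j => v j - q j) = v - q := rfl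
          have h2 : (fun j => x j - q j) = x - q := rfl
          rw [h1, h2, Matrix.mulVec_sub, Matrix.mulVec_sub]
          simp only [Pi.sub_apply]
          ring
        rw [e]
        nlinarith [sq_nonneg ((A.mulVec v - A.mulVec x) i - A.mulVec (fun j => x j - q j) i)]
    _ ≤ _ := by
        rw [Finset.sum_add_distrib, ← Finset.mul_sum, ← Finset.mul_sum]
        linarith

end

section

/-! ### Asymptotics of the parameters -/

theorem tendsto_logb_natCast : Tendsto (fun n : ℕ => Real.logb 2 (n : ℝ)) atTop atTop :=
  (Real.tendsto_logb_atTop one_lt_two).comp tendsto_natCast_atTop_atTop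

theorem tendsto_quantLevel {r : ℝ} (hr : 0 < r) : Tendsto (quantLevel r) atTop atTop :=
  tendsto_nat_floor_atTop.comp
    (((Real.tendsto_logb_atTop one_lt_two).comp tendsto_logb_natCast).const_mul_atTop hr)

/-- Here `(log n)^{2r} = 4^{r log log n}`, and rounding the exponent down loses a factor of at most
4. -/
theorem regCoeff_bounds {r : ℝ} (hr : 0 < r) :
    ∀ᶠ n : ℕ in atTop, (4 : ℝ) ^ quantLevel r n ≤ regCoeff r n ∧
      regCoeff r n ≤ 4 * 4 ^ quantLevel r n := by
  filter_upwards [tendsto_logb_natCast.eventually (eventually_ge_atTop 1)] with n hn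
  set L := Real.logb 2 (n : ℝ) with hL
  have hℓ : 0 ≤ r * Real.logb 2 L := mul_nonneg hr.le (Real.logb_nonneg one_lt_two hn)
  have e : regCoeff r n = (4 : ℝ) ^ (r * Real.logb 2 L) := by
    rw [regCoeff, ← hL, show (4 : ℝ) = 2 ^ (2 : ℝ) by norm_num, ← Real.rpow_mul two_pos.le]
    conv_lhs => rw [← Real.rpow_logb two_pos (by norm_num) (lt_of_lt_of_le one_pos hn),
      ← Real.rpow_mul two_pos.le]
    congr 1
    ring
  have e2 : (4 : ℝ) * 4 ^ quantLevel r n = (4 : ℝ) ^ ((quantLevel r n : ℝ) + 1) := by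
    rw [Real.rpow_add (by norm_num), Real.rpow_natCast, Real.rpow_one, mul_comm]
  rw [e, e2, ← Real.rpow_natCast]
  constructor
  · exact Real.rpow_le_rpow_of_exponent_le (by norm_num) (Nat.floor_le hℓ)
  · exact Real.rpow_le_rpow_of_exponent_le (by norm_num) (Nat.lt_floor_add_one _).le

theorem isLittleO_logb_rpow (p : ℝ) :
    (fun n : ℕ => Real.logb 2 (n : ℝ) ^ p) =o[atTop] fun n : ℕ => (n : ℝ) := by
  have h := (isLittleO_log_rpow_rpow_atTop p one_pos).comp_tendsto tendsto_natCast_atTop_atTop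
  have h2 := h.const_mul_left ((Real.log 2 ^ p)⁻¹)
  refine (h2.congr' ?_ ?_)
  · filter_upwards [eventually_ge_atTop 1] with n hn
    have : 0 ≤ Real.log (n : ℝ) := Real.log_nonneg (by exact_mod_cast hn)
    simp only [Function.comp_def, Real.logb]
    rw [Real.div_rpow this (Real.log_pos one_lt_two).le]
    field_simp
  · exact Eventually.of_forall fun n => by simp

theorem four_pow_quantLevel_le {r : ℝ} (hr : 0 < r) :
    ∀ᶠ n : ℕ in atTop, (4 : ℝ) ^ quantLevel r n ≤ n := by
  filter_upwards [regCoeff_bounds hr, (isLittleO_logb_rpow (2 * r)).bound one_pos] with n h1 h2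
  rw [one_mul, Real.norm_of_nonneg (Nat.cast_nonneg n)] at h2
  exact h1.1.trans ((le_abs_self _).trans h2)

/-- This bound suffices: it makes the number of initial contexts `n ^ k ≤ 2 ^ (log² n)`, which is
subexponential. -/
theorem le_logb_of_isLittleO {k : ℕ → ℕ} (hk : (fun n : ℕ => (k n : ℝ)) =o[atTop]
      fun n : ℕ => Real.logb 2 (n : ℝ) / Real.logb 2 (Real.logb 2 (n : ℝ))) :
    ∀ᶠ n : ℕ in atTop, (k n : ℝ) ≤ Real.logb 2 (n : ℝ) := by
  have h2 := ((Real.tendsto_logb_atTop one_lt_two).comp tendsto_logb_natCast).eventually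
    (eventually_ge_atTop 1)
  filter_upwards [hk.bound one_pos, h2,
    tendsto_logb_natCast.eventually (eventually_ge_atTop 0)] with n h1 h2 h3
  rw [one_mul, Real.norm_of_nonneg (Nat.cast_nonneg _)] at h1
  simp only [Function.comp_apply] at h2
  rw [Real.norm_of_nonneg (by positivity)] at h1
  exact h1.trans (div_le_self h3 h2)

/-- The exponent of the union bound per measurement: the gain `κ b` eventually beats `log b` and all
constants. -/
theorem eventually_exponent_le (κ K C : ℝ) (hκ : 0 < κ) (hC : 0 < C) :
    ∀ᶠ b : ℕ in atTop, -κ * b + 4 * K + Real.logb 2 (C * b) / 2 ≤ -1 := by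
  have h1 : (fun b : ℕ => Real.logb 2 (b : ℝ)) =o[atTop] fun b : ℕ => (b : ℝ) := by
    simpa using isLittleO_logb_rpow 1
  filter_upwards [h1.bound hκ, eventually_gt_atTop 0,
    (tendsto_natCast_atTop_atTop.const_mul_atTop (by positivity : 0 < κ / 2)).eventually
      (eventually_ge_atTop (4 * K + Real.logb 2 C / 2 + 1))] with b hb hb0 hb1
  have hb0' : (0 : ℝ) < b := by exact_mod_cast hb0
  rw [Real.norm_of_nonneg hb0'.le] at hb
  have := (le_abs_self _).trans hb
  rw [Real.logb_mul hC.ne' hb0'.ne']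
  linarith

/-- The union bound tends to zero. -/
theorem tendsto_unionBound {r : ℝ} (hr : 0 < r) (m k : ℕ → ℕ) (κ c D K σ : ℝ) (hκ : 0 < κ)
    (hc : 0 < c) (hD : 0 ≤ D) (hK : 0 < K) (hσ : 0 < σ)
    (hm : ∀ᶠ n : ℕ in atTop, D * n ≤ (1 - κ) * m n ∧ c * n ≤ m n)
    (hk : ∀ᶠ n : ℕ in atTop, (k n : ℝ) ≤ Real.logb 2 (n : ℝ)) :
    Tendsto (fun n : ℕ => (2 : ℝ) ^ (n * (D * quantLevel r n) + 4 * K * m n) * (n : ℝ) ^ k n *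
      ((Real.exp 1 * ((2 * n ^ 2 * (D * quantLevel r n) + 4 * K * m n * n) / 4 ^ quantLevel r n) /
        (m n * (σ * n))) ^ ((m n : ℝ) / 2) * (σ * n * 4 ^ quantLevel r n))) atTop (𝓝 0) := by
  set C : ℝ := Real.exp 1 * (2 * D / c + 4 * K) / σ with hC
  have hC0 : 0 < C := by positivity
  have hlim : Tendsto (fun n : ℕ => σ * (2 : ℝ) ^ (-(c / 2) * n)) atTop (𝓝 0) := by
    have h1 : Tendsto (fun n : ℕ => (2 : ℝ) ^ (-(c / 2) * n)) atTop (𝓝 0) :=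
      (tendsto_rpow_atBot_of_base_gt_one 2 one_lt_two).comp
        (tendsto_natCast_atTop_atTop.const_mul_atTop_of_neg (by linarith))
    simpa using h1.const_mul σ
  have hLn : ∀ᶠ n : ℕ in atTop, Real.logb 2 (n : ℝ) * Real.logb 2 (n : ℝ) +
      2 * Real.logb 2 (n : ℝ) ≤ c / 2 * n := by
    filter_upwards [(isLittleO_logb_rpow 2).bound (by positivity : 0 < c / 6),
      tendsto_logb_natCast.eventually (eventually_ge_atTop 1)] with n h1 h2
    rw [Real.norm_of_nonneg (by positivity), Real.norm_of_nonneg (by positivity),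
      Real.rpow_two] at h1
    nlinarith
  refine squeeze_zero' (Eventually.of_forall fun n => by positivity) ?_ hlim
  filter_upwards [hm, hk, hLn, four_pow_quantLevel_le hr, eventually_gt_atTop 0,
    (tendsto_quantLevel hr).eventually (eventually_ge_atTop 1),
    (tendsto_quantLevel hr).eventually (eventually_exponent_le κ K C hκ hC0)]
    with n ⟨hDm, hcm⟩ hkn hLn h4 hn hb1 hexp
  set b := quantLevel r n with hb
  have hn' : (0 : ℝ) < n := by exact_mod_cast hn
  have hb1' : (1 : ℝ) ≤ b := by exact_mod_cast hb1
  have hm0 : (0 : ℝ) < m n := lt_of_lt_of_le (by positivity) hcm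
  have h4pos : (0 : ℝ) < 4 ^ b := by positivity
  -- Because `n ≤ m / c` and `1 ≤ b`, both terms of the residual are at most a constant times `m n b
  -- / 4 ^ b`.
  have hθ : Real.exp 1 * ((2 * n ^ 2 * (D * b) + 4 * K * m n * n) / 4 ^ b) / (m n * (σ * n)) ≤
      C * b / 4 ^ b := by
    have h1 : 2 * (n : ℝ) ^ 2 * (D * b) + 4 * K * m n * n ≤
        (m n * n * b) * (2 * D / c + 4 * K) := by
      have h2 : (n : ℝ) ≤ m n / c := by rw [le_div_iff₀ hc]; linarith
      have h3 : 2 * (n : ℝ) ^ 2 * (D * b) ≤ m n * n * b * (2 * D / c) := by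
        calc 2 * (n : ℝ) ^ 2 * (D * b) = n * (n * b * (2 * D)) := by ring
          _ ≤ m n / c * (n * b * (2 * D)) := by gcongr
          _ = _ := by ring
      have h5 : 4 * K * m n * n ≤ m n * n * b * (4 * K) := by
        calc 4 * K * m n * n = (4 * K * m n * n) * 1 := by ring
          _ ≤ (4 * K * m n * n) * b := by gcongr
          _ = _ := by ring
      rw [mul_add]
      exact add_le_add h3 h5
    calc _ ≤ Real.exp 1 * (((m n * n * b) * (2 * D / c + 4 * K)) / 4 ^ b) / (m n * (σ * n)) := by
          gcongr
      _ = C * b / 4 ^ b := by rw [hC]; field_simp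
  -- Raised to the power `m / 2`, the factor `4 ^ (-b)` gives `2 ^ (-m b)`, against at most `2 ^ ((1
  -- - κ) m b)` from the count.
  have hCb : C * b / 4 ^ b = (2 : ℝ) ^ (Real.logb 2 (C * b) - 2 * b) := by
    rw [Real.rpow_sub two_pos, Real.rpow_logb two_pos (by norm_num) (by positivity),
      Real.rpow_mul two_pos.le, Real.rpow_natCast]
    norm_num
  have hn2 : (n : ℝ) = (2 : ℝ) ^ Real.logb 2 (n : ℝ) :=
    (Real.rpow_logb two_pos (by norm_num) hn').symm
  have hL0 : 0 ≤ Real.logb 2 (n : ℝ) := Real.logb_nonneg one_lt_two (by exact_mod_cast hn)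
  have hnk : (n : ℝ) ^ k n ≤ (2 : ℝ) ^ (Real.logb 2 (n : ℝ) * Real.logb 2 (n : ℝ)) := by
    calc (n : ℝ) ^ k n = (2 : ℝ) ^ (Real.logb 2 (n : ℝ) * k n) := by
          rw [Real.rpow_mul two_pos.le, ← hn2, Real.rpow_natCast]
      _ ≤ _ := Real.rpow_le_rpow_of_exponent_le one_le_two (by gcongr)
  have hnn : σ * n * 4 ^ b ≤ σ * (2 : ℝ) ^ (2 * Real.logb 2 (n : ℝ)) := by
    calc σ * n * 4 ^ b ≤ σ * n * n := by gcongr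
      _ = σ * ((2 : ℝ) ^ Real.logb 2 (n : ℝ) * (2 : ℝ) ^ Real.logb 2 (n : ℝ)) := by
          rw [← hn2, mul_assoc]
      _ = _ := by rw [← Real.rpow_add two_pos]; ring_nf
  have hB : (n : ℝ) * (D * b) + 4 * K * m n ≤ (1 - κ) * m n * b + 4 * K * m n := by
    have := mul_le_mul_of_nonneg_right hDm (Nat.cast_nonneg b : (0 : ℝ) ≤ b)
    linarith
  calc _ ≤ (2 : ℝ) ^ ((1 - κ) * m n * b + 4 * K * m n) *
        (2 : ℝ) ^ (Real.logb 2 (n : ℝ) * Real.logb 2 (n : ℝ)) *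
        (((2 : ℝ) ^ (Real.logb 2 (C * b) - 2 * b)) ^ ((m n : ℝ) / 2) *
          (σ * (2 : ℝ) ^ (2 * Real.logb 2 (n : ℝ)))) := by
        rw [← hCb]
        gcongr
        exact one_le_two
    _ = σ * (2 : ℝ) ^ (m n * (-κ * b + 4 * K + Real.logb 2 (C * b) / 2) +
          (Real.logb 2 (n : ℝ) * Real.logb 2 (n : ℝ) + 2 * Real.logb 2 (n : ℝ))) := by
        rw [← Real.rpow_mul two_pos.le, ← Real.rpow_add two_pos,
          mul_left_comm _ σ, mul_left_comm _ σ, ← Real.rpow_add two_pos, ← Real.rpow_add two_pos]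
        congr 2
        ring
    _ ≤ σ * (2 : ℝ) ^ (-(c / 2) * n) := by
        refine mul_le_mul_of_nonneg_left ?_ hσ.le
        refine Real.rpow_le_rpow_of_exponent_le one_le_two ?_
        have := mul_le_mul_of_nonneg_left hexp hm0.le
        linarith

/-- Constants with which the number of measurements dominates the information dimension. -/
theorem exists_rate_constants (d : ℝ≥0∞) (hdtop : d ≠ ∞) (δ : ℝ) (hδ : 0 < δ) (m : ℕ → ℕ)
    (hm : ∀ n : ℕ, ENNReal.ofReal (1 + δ) * d * (n : ℝ≥0∞) ≤ (m n : ℝ≥0∞))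
    (hm0 : d = 0 → ∃ c : ℝ, 0 < c ∧ ∀ᶠ n : ℕ in atTop, c * (n : ℝ) ≤ (m n : ℝ)) :
    ∃ ε κ c : ℝ, 0 < ε ∧ 0 < κ ∧ 0 < c ∧ ∀ᶠ n : ℕ in atTop,
      (d.toReal + ε) * n ≤ (1 - κ) * m n ∧ c * n ≤ m n := by
  by_cases h0 : d = 0
  · obtain ⟨c, hc, h⟩ := hm0 h0
    refine ⟨c / 2, 1 / 2, c, by positivity, by norm_num, hc, ?_⟩
    filter_upwards [h] with n hn
    refine ⟨?_, hn⟩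
    rw [h0, ENNReal.toReal_zero]
    linarith
  · have hD : 0 < d.toReal := ENNReal.toReal_pos h0 hdtop
    have hmr : ∀ n : ℕ, (1 + δ) * d.toReal * n ≤ m n := by
      intro n
      have := ENNReal.toReal_mono (ENNReal.natCast_ne_top _) (hm n)
      rwa [ENNReal.toReal_mul, ENNReal.toReal_mul, ENNReal.toReal_ofReal (by positivity),
        ENNReal.toReal_natCast, ENNReal.toReal_natCast] at this
    -- Half of the oversampling `δ` goes into `ε`; the other half is left as `κ`, with `1 - κ = (1 +
    -- δ / 2) / (1 + δ)`.
    refine ⟨d.toReal * δ / 2, δ / 2 / (1 + δ), (1 + δ) * d.toReal, by positivity, by positivity,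
      by positivity, Eventually.of_forall fun n => ⟨?_, hmr n⟩⟩
    have h1 : 1 - δ / 2 / (1 + δ) = (1 + δ / 2) / (1 + δ) := by field_simp; ring
    rw [h1]
    calc (d.toReal + d.toReal * δ / 2) * n
        = (1 + δ / 2) / (1 + δ) * ((1 + δ) * d.toReal * n) := by field_simp
      _ ≤ _ := by gcongr; exact hmr n

variable {Ω : Type*} [MeasurableSpace Ω] {μ : Measure Ω}

/-- Quantization errors are at most `2 ^ (-b)` per coordinate, so the mean of the sum is at most `m
n / 4 ^ b`; the rest is Markov's inequality. -/
theorem measure_mulVec_gt_le [IsProbabilityMeasure μ] {m n : ℕ} (hm : 0 < m) (hn : 0 < n)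
    {A : Ω → Matrix (Fin m) (Fin n) ℝ}
    (hAlaw : ∀ i j, HasLaw (fun ω => A ω i j) (gaussianReal 0 1) μ)
    (hAindep : iIndepFun (fun (p : Fin m × Fin n) ω => A ω p.1 p.2) μ) (x : Ω → Fin n → ℝ)
    (hx : Measurable x) (hAx : IndepFun (fun ω (p : Fin m × Fin n) => A ω p.1 p.2) x μ)
    (b : ℕ) (K : ℝ) (hK : 0 < K) :
    μ {ω | K * m * n / 4 ^ b ≤
        ∑ i, (A ω).mulVec (fun j => x ω j - quantize b (x ω j)) i ^ 2} ≤ ENNReal.ofReal (1 / K) := by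
  have hm' : (0 : ℝ) < m := by exact_mod_cast hm
  have hn' : (0 : ℝ) < n := by exact_mod_cast hn
  set g : (Fin n → ℝ) → Fin n → ℝ := fun y j => y j - quantize b (y j) with hg
  have hgm : Measurable g := measurable_pi_lambda _ fun j =>
    (measurable_pi_apply j).sub ((measurable_quantize b).comp (measurable_pi_apply j))
  have hbd : ∀ ω j, |g (x ω) j| ≤ (1 / 2) ^ b := fun ω j => by
    rw [abs_of_nonneg (sub_nonneg.2 (quantize_le b _))]
    exact (sub_quantize_lt b _).le
  have hE := lintegral_mulVec_sq_le hAlaw hAindep (fun ω => g (x ω)) (hgm.comp hx)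
    (hAx.comp measurable_id hgm) _ hbd
  have hae : AEMeasurable (fun ω => ENNReal.ofReal (∑ i, (A ω).mulVec (g (x ω)) i ^ 2)) μ := by
    refine AEMeasurable.ennreal_ofReal (Finset.aemeasurable_fun_sum (M := ℝ) _ fun i _ => ?_)
    refine AEMeasurable.pow_const ?_ 2
    simp only [Matrix.mulVec, dotProduct]
    refine Finset.aemeasurable_fun_sum (M := ℝ) _ fun j _ => ?_
    exact (hAlaw i j).aemeasurable.mul
      ((measurable_pi_apply j).comp (hgm.comp hx)).aemeasurable
  have hpos : 0 < K * m * n / 4 ^ b := by positivity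
  have h1 := meas_ge_le_lintegral_div hae (ε := ENNReal.ofReal (K * m * n / 4 ^ b))
    (by simpa using hpos) ENNReal.ofReal_ne_top
  refine (measure_mono fun ω hω => ENNReal.ofReal_le_ofReal hω).trans (h1.trans ?_)
  refine (ENNReal.div_le_div_right hE _).trans ?_
  rw [← ENNReal.ofReal_div_of_pos hpos]
  apply ENNReal.ofReal_le_ofReal
  have : ((1 / 2 : ℝ) ^ b) ^ 2 = 1 / 4 ^ b := by
    rw [← pow_mul, mul_comm, pow_mul, one_div, one_div, inv_pow, inv_pow]; norm_num
  rw [this]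
  apply le_of_eq
  field_simp

end

/-! ### Failure events and the conclusion -/

theorem mem_range_gridPoint_of_mem {𝒳 : Set ℝ} {b : ℕ} {v : ℝ} (hv : v ∈ quantizedAlphabet 𝒳 b) :
    v ∈ Set.range (gridPoint b) := by
  obtain ⟨x, -, rfl⟩ := hv
  exact ⟨_, gridPoint_floor b x⟩

theorem norm_sub_quantize_le {n : ℕ} (b : ℕ) (x : Fin n → ℝ) :
    ‖WithLp.toLp 2 (fun i => x i - quantize b (x i))‖ ≤ √n * (1 / 2) ^ b := by
  refine le_of_sq_le_sq ?_ (by positivity)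
  rw [toLp_norm_sq, mul_pow, Real.sq_sqrt (Nat.cast_nonneg n)]
  calc ∑ i, (x i - quantize b (x i)) ^ 2 ≤ ∑ _i : Fin n, ((1 / 2 : ℝ) ^ b) ^ 2 := by
        gcongr with i _
        · exact sub_nonneg.2 (quantize_le b _)
        · exact (sub_quantize_lt b _).le
    _ = _ := by simp

/-- Quantization moves `x` by at most `√n ε / 2`, so the triangle inequality leaves half of the
error between `v` and the quantized signal. -/
theorem le_sum_sq_of_le_norm {n : ℕ} (hn : 0 < n) (b : ℕ) (ε : ℝ) (hε : 0 < ε)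
    (hb : (1 / 2 : ℝ) ^ b ≤ ε / 2) (x v : Fin n → ℝ)
    (h : ε ≤ 1 / √n * ‖WithLp.toLp 2 (x - v)‖) :
    (ε / 2) ^ 2 * n ≤ ∑ i, (v i - quantize b (x i)) ^ 2 := by
  have hs : 0 < √(n : ℝ) := Real.sqrt_pos.2 (by exact_mod_cast hn)
  rw [one_div, ← div_eq_inv_mul, le_div_iff₀ hs] at h
  have e : WithLp.toLp 2 (x - v) = WithLp.toLp 2 (fun i => x i - quantize b (x i)) -
      WithLp.toLp 2 (fun i => v i - quantize b (x i)) := by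
    rw [← WithLp.toLp_sub]
    congr 1
    funext i
    simp
  have h1 : ε * √n ≤ √n * (1 / 2) ^ b + ‖WithLp.toLp 2 (fun i => v i - quantize b (x i))‖ := by
    rw [e] at h
    exact h.trans ((norm_sub_le _ _).trans (by gcongr; exact norm_sub_quantize_le b x))
  have h2 : ε / 2 * √n ≤ ‖WithLp.toLp 2 (fun i => v i - quantize b (x i))‖ := by
    have := mul_le_mul_of_nonneg_left hb hs.le
    linarith
  have h3 := pow_le_pow_left₀ (by positivity) h2 2
  rwa [mul_pow, Real.sq_sqrt (Nat.cast_nonneg n), toLp_norm_sq] at h3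

/-- The three events that cover a large reconstruction error. -/
theorem reconstruction_error_cases {m n k b : ℕ} (hkn : k + 1 < n) {𝒳 : Set ℝ} {lam : ℝ}
    (hlam1 : (4 : ℝ) ^ b ≤ lam) (hlam2 : lam ≤ 4 * 4 ^ b) {A : Matrix (Fin m) (Fin n) ℝ}
    {x v : Fin n → ℝ} (hx : ∀ i, x i ∈ 𝒳)
    (hv : IsAMEPSolution k (quantizedAlphabet 𝒳 b) (empWeight k fun i => quantize b (x i)) lam A
      (A.mulVec x) v) (ε h K : ℝ) (hε : 0 < ε) (hb : (1 / 2 : ℝ) ^ b ≤ ε / 2) (hh : 0 ≤ h)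
    (hK : 0 < K) (herr : ε ≤ 1 / √n * ‖WithLp.toLp 2 (x - v)‖) :
    (¬ linearCost k (quantizedAlphabet 𝒳 b) (empWeight k fun i => quantize b (x i))
        (fun i => quantize b (x i)) ≤ ENNReal.ofReal h) ∨
    (K * m * n / 4 ^ b ≤ ∑ i, A.mulVec (fun j => x j - quantize b (x j)) i ^ 2) ∨
    ∃ v : Fin n → ℝ, (∀ i, v i ∈ Set.range (gridPoint b)) ∧
        ∑ t, empWeight k (fun i => quantize b (x i)) (window k v t) ≤
          ENNReal.ofReal (n * h + 4 * K * m) ∧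
        (ε / 2) ^ 2 * n ≤ ∑ i, (v i - quantize b (x i)) ^ 2 ∧
        ∑ i, A.mulVec (fun j => v j - quantize b (x j)) i ^ 2 ≤
          (2 * n ^ 2 * h + 4 * K * m * n) / 4 ^ b := by
  by_cases h1 : linearCost k (quantizedAlphabet 𝒳 b) (empWeight k fun i => quantize b (x i))
        (fun i => quantize b (x i)) ≤ ENNReal.ofReal h
  swap
  · exact Or.inl h1
  by_cases h2 : K * m * n / 4 ^ b ≤ ∑ i, A.mulVec (fun j => x j - quantize b (x j)) i ^ 2
  · exact Or.inr (Or.inl h2)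
  refine Or.inr (Or.inr ⟨v, fun i => mem_range_gridPoint_of_mem (hv.1 i), ?_,
    le_sum_sq_of_le_norm (by omega) b ε hε hb x v herr, ?_⟩)
  all_goals
    have h4 : (0 : ℝ) < 4 ^ b := by positivity
    have hlam0 : 0 < lam := h4.trans_le hlam1
    have hn' : (0 : ℝ) < n := by
      have : 0 < n := by omega
      exact_mod_cast this
    obtain ⟨hc, hr⟩ := hv.bounds hlam0 (by omega) (fun i => Set.mem_image_of_mem _ (hx i)) h _ hh h1
      (not_le.1 h2).le
  · rw [linearCost_eq k hkn _ _ v hv.1] at hc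
    have hM : ((n - (k + 1) : ℕ) : ℝ≥0∞) ≠ 0 := by
      have : n - (k + 1) ≠ 0 := by omega
      exact_mod_cast this
    have hMn : ((n - (k + 1) : ℕ) : ℝ) ≤ n := by exact_mod_cast Nat.sub_le _ _
    rw [ENNReal.div_le_iff hM (ENNReal.natCast_ne_top _)] at hc
    refine hc.trans ?_
    rw [← ENNReal.ofReal_natCast, ← ENNReal.ofReal_mul (by positivity)]
    apply ENNReal.ofReal_le_ofReal
    -- The upper bound on `λ` keeps the penalty of the quantized signal of order `m / n`; the lower
    -- bound serves in the other goal, where it makes the residual small.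
    have h5 : lam / n ^ 2 * (K * m * n / 4 ^ b) ≤ 4 * K * m / n := by
      calc lam / n ^ 2 * (K * m * n / 4 ^ b) ≤ 4 * 4 ^ b / n ^ 2 * (K * m * n / 4 ^ b) := by gcongr
        _ = _ := by field_simp
    calc _ ≤ (h + 4 * K * m / n) * n := by gcongr
      _ = _ := by field_simp
  · refine hr.trans ?_
    have h5 : (n : ℝ) ^ 2 * h / lam ≤ n ^ 2 * h / 4 ^ b := by gcongr
    calc _ ≤ 2 * ((n : ℝ) ^ 2 * h / 4 ^ b) + 4 * (K * m * n / 4 ^ b) := by linarith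
      _ = _ := by ring

end CompressedSensing

end

open CompressedSensing in
theorem mainTheorem2 {Ω : Type*} [MeasurableSpace Ω] (μ : Measure Ω) [IsProbabilityMeasure μ]
    -- a stationary mixing source with alphabet `𝒳` and upper information dimension `d`
    (X : ℤ → Ω → ℝ) (hXmeas : ∀ i, Measurable (X i))
    (𝒳 : Set ℝ) (hX𝒳 : ∀ i, ∀ᵐ ω ∂μ, X i ω ∈ 𝒳)
    (hstat : CompressedSensing.IsStationary X μ)
    (hmix : CompressedSensing.IsPsiStarMixing X μ)
    (d : ℝ≥0∞) (hd : CompressedSensing.IsUpperInfoDim X μ d)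
    -- parameters
    (r δ : ℝ) (hr : 1 < r) (hδ : 0 < δ)
    (m : ℕ → ℕ) (hm : ∀ n : ℕ, ENNReal.ofReal (1 + δ) * d * (n : ℝ≥0∞) ≤ (m n : ℝ≥0∞))
    (hm0 : d = 0 → ∃ c : ℝ, 0 < c ∧ ∀ᶠ n : ℕ in atTop, c * (n : ℝ) ≤ (m n : ℝ))
    (k : ℕ → ℕ) (hkdiv : Tendsto k atTop atTop)
    (hk : (fun n : ℕ => (k n : ℝ)) =o[atTop]
      fun n : ℕ => Real.logb 2 (n : ℝ) / Real.logb 2 (Real.logb 2 (n : ℝ)))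
    -- measurement matrices with i.i.d. standard Gaussian entries, independent of the signal
    (A : (n : ℕ) → Ω → Matrix (Fin (m n)) (Fin n) ℝ)
    (hAlaw : ∀ n i j, HasLaw (fun ω => A n ω i j) (gaussianReal 0 1) μ)
    (hAindep : ∀ n, iIndepFun (fun (p : Fin (m n) × Fin n) ω => A n ω p.1 p.2) μ)
    (hAX : ∀ n, IndepFun (fun ω (p : Fin (m n) × Fin n) => A n ω p.1 p.2)
      (CompressedSensing.initialBlock X n) μ)
    -- the decoder's output: any minimizer of the objective for the weights computed from `[X^n]_b`
    (Xhat : (n : ℕ) → Ω → Fin n → ℝ)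
    (hXhat : ∀ᶠ n : ℕ in atTop, ∀ᵐ ω ∂μ,
      CompressedSensing.IsAMEPSolution (k n)
        (CompressedSensing.quantizedAlphabet 𝒳 (CompressedSensing.quantLevel r n))
        (CompressedSensing.empWeight (k n)
          (fun i => CompressedSensing.quantize (CompressedSensing.quantLevel r n)
            (CompressedSensing.initialBlock X n ω i)))
        (CompressedSensing.regCoeff r n) (A n ω)
        ((A n ω).mulVec (CompressedSensing.initialBlock X n ω)) (Xhat n ω)) :
    TendstoInMeasure μ
      (fun (n : ℕ) ω => 1 / Real.sqrt (n : ℝ) *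
        ‖WithLp.toLp 2 (CompressedSensing.initialBlock X n ω - Xhat n ω)‖)
      atTop (fun _ => (0 : ℝ)) := by
  -- Already for `n = 1` an infinite dimension would force infinitely many measurements.
  have hdtop : d ≠ ∞ := by
    rintro rfl
    have := hm 1
    rw [ENNReal.mul_top (by simpa using by linarith), Nat.cast_one, mul_one, top_le_iff] at this
    exact ENNReal.natCast_ne_top _ this
  have hr0 : 0 < r := by linarith
  obtain ⟨ε₁, κ, c, hε₁, hκ, hc, hrate⟩ := exists_rate_constants d hdtop δ hδ m hm hm0
  set D : ℝ := d.toReal + ε₁ with hD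
  have hD0 : 0 < D := by positivity
  rw [tendstoInMeasure_iff_dist]
  intro ε hε
  rw [ENNReal.tendsto_nhds_zero]
  intro η' hη'
  obtain ⟨η, hη, hηη'⟩ : ∃ η : ℝ, 0 < η ∧ ENNReal.ofReal η ≤ η' := by
    rcases eq_or_ne η' ∞ with rfl | htop
    · exact ⟨1, one_pos, le_top⟩
    · exact ⟨η'.toReal, ENNReal.toReal_pos hη'.ne' htop, (ENNReal.ofReal_toReal htop).le⟩
  -- Makes the Markov bound `1 / K` for the quantization noise equal to `η / 3`, one third of the
  -- budget.
  set K : ℝ := 3 / η with hK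
  have hK0 : 0 < K := by positivity
  obtain ⟨k₀, b₁, M₁, hconc⟩ := linearCost_self_concentration hXmeas 𝒳 hX𝒳 hstat hmix d hd hdtop
    ε₁ (η / 3) hε₁ (by positivity)
  have hklog := le_logb_of_isLittleO hk
  have hunion : ∀ᶠ n : ℕ in atTop,
      ENNReal.ofReal ((2 : ℝ) ^ (n * (D * quantLevel r n) + 4 * K * m n)) * (n : ℝ≥0∞) ^ k n *
        (ENNReal.ofReal ((Real.exp 1 *
          ((2 * n ^ 2 * (D * quantLevel r n) + 4 * K * m n * n) / 4 ^ quantLevel r n) /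
          (m n * ((ε / 2) ^ 2 * n))) ^ ((m n : ℝ) / 2)) *
          (ENNReal.ofReal ((ε / 2) ^ 2 * n * 4 ^ quantLevel r n) * latticeSum)) ≤
        ENNReal.ofReal (η / 3) := by
    have h0 := tendsto_unionBound hr0 m k κ c D K ((ε / 2) ^ 2) hκ hc hD0.le hK0 (by positivity)
      hrate hklog
    have h1 := ENNReal.Tendsto.mul_const (ENNReal.tendsto_ofReal h0)
      (b := latticeSum) (Or.inr latticeSum_ne_top)
    rw [ENNReal.ofReal_zero, zero_mul] at h1
    filter_upwards [h1.eventually (ge_mem_nhds (by simpa using hη : 0 < ENNReal.ofReal (η / 3)))]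
      with n hn
    refine le_trans (le_of_eq ?_) hn
    have key : ∀ (a θ s : ℝ) (j : ℕ), 0 ≤ a → 0 ≤ θ → ENNReal.ofReal a * (n : ℝ≥0∞) ^ j *
        (ENNReal.ofReal θ * (ENNReal.ofReal s * latticeSum)) =
        ENNReal.ofReal (a * (n : ℝ) ^ j * (θ * s)) * latticeSum := by
      intro a θ s j ha hθ
      rw [ENNReal.ofReal_mul (by positivity), ENNReal.ofReal_mul ha, ENNReal.ofReal_mul hθ,
        ENNReal.ofReal_pow (Nat.cast_nonneg n), ENNReal.ofReal_natCast]
      ring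
    exact key _ _ _ _ (by positivity) (by positivity)
  have hkM : ∀ᶠ n : ℕ in atTop, k n + 1 + (M₁ + 1) ≤ n := by
    filter_upwards [hklog, (isLittleO_logb_rpow 1).bound (by norm_num : (0 : ℝ) < 1 / 2),
      tendsto_natCast_atTop_atTop.eventually (eventually_ge_atTop ((2 : ℝ) * (M₁ + 2)))]
      with n h1 h2 h3
    rw [Real.rpow_one, Real.norm_of_nonneg (Nat.cast_nonneg n)] at h2
    have := (le_abs_self _).trans h2
    have h4 : (k n : ℝ) + 1 + (M₁ + 1) ≤ n := by linarith
    exact_mod_cast h4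
  have hm2 : ∀ᶠ n : ℕ in atTop, 2 ≤ m n := by
    filter_upwards [hrate, (tendsto_natCast_atTop_atTop.const_mul_atTop hc).eventually
      (eventually_ge_atTop 2)] with n h1 h2
    exact_mod_cast h2.trans h1.2
  have hσ : ∀ᶠ n : ℕ in atTop, 1 ≤ (ε / 2) ^ 2 * (n : ℝ) :=
    (tendsto_natCast_atTop_atTop.const_mul_atTop (by positivity)).eventually (eventually_ge_atTop 1)
  have hbε : ∀ᶠ n : ℕ in atTop, (1 / 2 : ℝ) ^ quantLevel r n ≤ ε / 2 :=
    (tendsto_quantLevel hr0).eventually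
      ((tendsto_pow_atTop_nhds_zero_of_lt_one (by norm_num) (by norm_num)).eventually
        (ge_mem_nhds (by positivity)))
  filter_upwards [hXhat, hunion, hkM, hm2, hσ, hbε, regCoeff_bounds hr0,
    hkdiv.eventually (eventually_ge_atTop k₀),
    (tendsto_quantLevel hr0).eventually (eventually_ge_atTop (max b₁ 1))]
    with n hsol hbound hkn hm2 hσ hbε hlam hk₀ hb
  set b := quantLevel r n with hbdef
  have hn0 : 0 < n := by omega
  have hn' : (0 : ℝ) < n := by exact_mod_cast hn0
  have hm' : (0 : ℝ) < m n := by
    have : 0 < m n := by omega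
    exact_mod_cast this
  have hb' : (0 : ℝ) < b := by
    have : 0 < b := (le_max_right _ _).trans hb
    exact_mod_cast this
  have hxm : Measurable (initialBlock X n) := measurable_initialBlock hXmeas n
  have hE1 := hconc (k n) b n hk₀ ((le_max_left _ _).trans hb) (by omega) (by omega)
  have hE2 := measure_mulVec_gt_le (by omega) hn0 (hAlaw n) (hAindep n) _ hxm (hAX n) b K hK0
  have hE3 := (measure_exists_bad_le (k := k n) (b := b) (by omega) hxm (hAlaw n) (hAindep n)
    (hAX n) hm2
    (n * (D * b) + 4 * K * m n) ((ε / 2) ^ 2 * n)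
    ((2 * n ^ 2 * (D * b) + 4 * K * m n * n) / 4 ^ b) (by positivity)
    (one_le_mul_of_one_le_of_one_le hσ (one_le_pow₀ (by norm_num))) (by positivity)
    (by positivity)).trans hbound
  refine le_trans ?_ hηη'
  -- The cover is used only through monotonicity and subadditivity, which hold for arbitrary sets,
  -- so no measurability of these events is needed.
  have hcover : {ω | ε ≤ dist (1 / √(n : ℝ) *
        ‖WithLp.toLp 2 (initialBlock X n ω - Xhat n ω)‖) 0} ≤ᵐ[μ]
      ({ω | ¬ linearCost (k n) (quantizedAlphabet 𝒳 b)
          (empWeight (k n) (fun i => quantize b (initialBlock X n ω i)))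
          (fun i => quantize b (initialBlock X n ω i)) ≤ ENNReal.ofReal (D * b)} ∪
        ({ω | K * m n * n / 4 ^ b ≤ ∑ i, (A n ω).mulVec
          (fun j => initialBlock X n ω j - quantize b (initialBlock X n ω j)) i ^ 2} ∪
        {ω | ∃ v : Fin n → ℝ, (∀ i, v i ∈ Set.range (gridPoint b)) ∧
          ∑ t, empWeight (k n) (fun i => quantize b (initialBlock X n ω i)) (window (k n) v t) ≤
            ENNReal.ofReal (n * (D * b) + 4 * K * m n) ∧
          (ε / 2) ^ 2 * n ≤ ∑ i, (v i - quantize b (initialBlock X n ω i)) ^ 2 ∧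
          ∑ i, (A n ω).mulVec (fun j => v j - quantize b (initialBlock X n ω j)) i ^ 2 ≤
            (2 * n ^ 2 * (D * b) + 4 * K * m n * n) / 4 ^ b}) : Set Ω) := by
    filter_upwards [hsol, ae_all_iff.2 hX𝒳] with ω hω hω𝒳 herr
    have herr' : ε ≤ 1 / √(n : ℝ) * ‖WithLp.toLp 2 (initialBlock X n ω - Xhat n ω)‖ := by
      have h : ε ≤ dist (1 / √(n : ℝ) *
        ‖WithLp.toLp 2 (initialBlock X n ω - Xhat n ω)‖) 0 := herr
      rwa [Real.dist_0_eq_abs, abs_of_nonneg (by positivity)] at h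
    exact reconstruction_error_cases (by omega) hlam.1 hlam.2 (fun i => hω𝒳 _) hω ε (D * b) K hε
      hbε (by positivity) hK0 herr'
  calc _ ≤ _ := measure_mono_ae hcover
    _ ≤ ENNReal.ofReal (η / 3) + (ENNReal.ofReal (η / 3) + ENNReal.ofReal (η / 3)) := by
        refine (measure_union_le _ _).trans (add_le_add hE1 ?_)
        refine (measure_union_le _ _).trans (add_le_add (hE2.trans (le_of_eq ?_)) hE3)
        rw [hK, one_div_div]
    _ = ENNReal.ofReal η := by
        rw [← ENNReal.ofReal_add (by positivity) (by positivity),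
          ← ENNReal.ofReal_add (by positivity) (by positivity)]
        congr 1
        ring
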